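/- Let $n\ge 2$ and $k\in\mathbb{N}_0$. Write points of $\mathbb{R}^n$ as $x=(\bar x,x_n)$ with $\bar x\in\mathbb{R}^{n-1}$, and put $\mathbb{R}^n_+=\{x: x_n>0\}$ and $\mathbb{S}^{n-1}_+=\{v\in\mathbb{S}^{n-1}: v_n>0\}$. For a real-valued $f\in C_c^\infty(\mathbb{R}^n_+)$ let $$R^kf(a,v)=\int_0^\infty f(a+rv)\,r^k\,dr$$ be its $k$-weighted divergent beam transform. Let $u\in C^\infty(\mathbb{R}^{n-1}\times\mathbb{S}^{n-1}_+)$ be real-valued, and let $$w(\bar a,\bar p)=v_n^{k+1}u(\bar a,v),\qquad \bar p=\frac{\bar v}{v_n}\in\mathbb{R}^{n-1},$$ be the scaled projective data. Then there exists $f\in C_c^\infty(\mathbb{R}^n_+)$ with $u(\bar a,v)=R^kf((\bar a,0),v)$ for all $\bar a\in\mathbb{R}^{n-1}$ and $v\in\mathbb{S}^{n-1}_+$ if and only if the following three conditions hold. (i) For every $\bar a\in\mathbb{R}^{n-1}$ the function $w(\bar a,\cdot)$ has compact support. (ii) For every $m\in\mathbb{N}_0$ there are homogeneous polynomials $c_{m,j}(\bar\xi)$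 of degree $m-j$, $j=0,\dots,m$, such that for all $\bar a,\bar\xi\in\mathbb{R}^{n-1}$ $$J_m(\bar a,\bar\xi):=\int_{\mathbb{R}^{n-1}}(\bar p\cdot\bar\xi)^m\,w(\bar a,\bar p)\,d\bar p=\sum_{j=0}^m c_{m,j}(\bar\xi)\,(\bar a\cdot\bar\xi)^j .$$ (iii) With $Q_j(\bar\xi)=\sum_{m\ge j}\frac{(-i)^m}{m!}c_{m,j}(\bar\xi)$, the power series $\sum_{j\ge0}Q_j(\bar\xi)\sigma^j$ defines an entire function $H(\sigma,\bar\xi)$ on $\mathbb{C}\times\mathbb{C}^{n-1}$, and there are constants $0<m_0<M_0<\infty$ and $R>0$ such that for every integer $N\ge0$ there is $C_N>0$ with $$|H(\sigma,\bar\xi)|\le C_N(1+|\sigma|+|\bar\xi|)^{-N}\exp\Big(\max_{t\in\{-m_0,-M_0\}}t\big(\operatorname{Im}\sigma-R\,|\operatorname{Im}\bar\xi|\big)\Big)\quad\text{for all }(\sigma,\bar\xi)\in\mathbb{C}\times\mathbb{C}^{n-1}.$$ -/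

import Mathlib

open scoped ContDiff Manifold

noncomputable section

namespace DivergentBeam

/-- `ℝ^d`; throughout `d = n - 1`, so that `ℝ^n` is `E (d + 1)`. -/
abbrev E (d : ℕ) : Type := EuclideanSpace ℝ (Fin d)

/-- The point `(x̄, t)` of `ℝ^n = ℝ^{n-1} × ℝ`. -/
def mk {d : ℕ} (xbar : E d) (t : ℝ) : E (d + 1) :=
  WithLp.toLp 2 (Fin.snoc (α := fun _ => ℝ) (fun i => xbar i) t)

/-- The first `n - 1` coordinates `x̄` of `x = (x̄, x_n)`. -/
def bar {d : ℕ} (x : E (d + 1)) : E d := WithLp.toLp 2 (fun i => x i.castSucc)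

/-- The last coordinate `x_n` of `x = (x̄, x_n)`. -/
def last {d : ℕ} (x : E (d + 1)) : ℝ := x (Fin.last d)

/-- The open upper hemisphere of the unit sphere of `ℝ^n`, an open submanifold of the sphere. -/
def upperHemisphere (d : ℕ) : TopologicalSpace.Opens (Metric.sphere (0 : E (d + 1)) 1) where
  carrier := {v | 0 < last (v : E (d + 1))}
  is_open' := by
    have h : Continuous fun v : Metric.sphere (0 : E (d + 1)) 1 => last (v : E (d + 1)) := by
      unfold last
      fun_prop
    exact isOpen_lt continuous_const h

/-- A point of the upper hemisphere as a vector of `ℝ^n`. -/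
def dirVec {d : ℕ} (v : upperHemisphere d) : E (d + 1) := ((v : Metric.sphere (0 : E (d + 1)) 1) : E (d + 1))

/-- `u ∈ C^∞(ℝ^{n-1} × S^{n-1}_+)`. -/
def SmoothData {d : ℕ} (u : E d × upperHemisphere d → ℝ) : Prop :=
  ContMDiff (𝓘(ℝ, E d).prod (𝓡 d)) 𝓘(ℝ, ℝ) ∞ u

/-- `f ∈ C_c^∞(ℝ^n_+)`: smooth on `ℝ^n`, with compact support contained in `{x_n > 0}`. -/
def IsTestFunction {d : ℕ} (f : E (d + 1) → ℝ) : Prop :=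
  ContDiff ℝ ∞ f ∧ HasCompactSupport f ∧ tsupport f ⊆ {x | 0 < last x}

/-- The `k`-weighted divergent beam transform `R^k f(a, v) = ∫_0^∞ f(a + r v) r^k dr`. -/
def beamTransform {d : ℕ} (k : ℕ) (f : E (d + 1) → ℝ) (a v : E (d + 1)) : ℝ :=
  ∫ r in Set.Ioi (0 : ℝ), f (a + r • v) * r ^ k

lemma norm_sq_mk {d : ℕ} (x : E d) (t : ℝ) : ‖mk x t‖ ^ 2 = ‖x‖ ^ 2 + t ^ 2 := by
  simp [EuclideanSpace.norm_sq_eq, mk, Fin.sum_univ_castSucc]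

lemma norm_mk_one_pos {d : ℕ} (p : E d) : 0 < ‖mk p 1‖ := by
  have h := norm_sq_mk p 1
  rcases (norm_nonneg (mk p 1)).eq_or_lt with h0 | h0
  · rw [← h0] at h
    nlinarith [sq_nonneg ‖p‖]
  · exact h0

/-- The unique direction `v` in the upper hemisphere with `v̄ / v_n = p̄`,
namely `v = (p̄, 1) / |(p̄, 1)|`. -/
def direction {d : ℕ} (p : E d) : upperHemisphere d :=
  ⟨⟨‖mk p 1‖⁻¹ • mk p 1, by
      simp [norm_smul, (norm_mk_one_pos p).ne']⟩, by
      have h := norm_mk_one_pos p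
      change 0 < last (‖mk p 1‖⁻¹ • mk p 1)
      simpa [last, mk] using h⟩

/-- The scaled projective data `w(ā, p̄) = v_n^{k+1} u(ā, v)`, where `p̄ = v̄ / v_n`. -/
def scaledData {d : ℕ} (k : ℕ) (u : E d × upperHemisphere d → ℝ) (a p : E d) : ℝ :=
  last (dirVec (direction p)) ^ (k + 1) * u (a, direction p)

lemma direction_bar_div_last {d : ℕ} (v : upperHemisphere d) :
    direction ((last (dirVec v))⁻¹ • bar (dirVec v)) = v := by
  have hv : 0 < last (dirVec v) := v.2
  have hn : ‖dirVec v‖ = 1 := by simp [dirVec]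
  have hmk : mk ((last (dirVec v))⁻¹ • bar (dirVec v)) 1 = (last (dirVec v))⁻¹ • dirVec v := by
    ext i
    refine Fin.lastCases ?_ (fun i => ?_) i
    · have : dirVec v (Fin.last d) ≠ 0 := hv.ne'
      simp [mk, last, this]
    · simp [mk, bar]
  apply Subtype.ext
  apply Subtype.ext
  change ‖mk _ 1‖⁻¹ • mk _ 1 = dirVec v
  rw [hmk, norm_smul, hn, smul_smul]
  simp [abs_of_pos hv, hv.ne']

/-- The defining relation of `w` for an arbitrary direction `v` of the upper hemisphere. -/
lemma scaledData_bar_div_last {d : ℕ} (k : ℕ) (u : E d × upperHemisphere d → ℝ) (a : E d)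
    (v : upperHemisphere d) :
    scaledData k u a ((last (dirVec v))⁻¹ • bar (dirVec v)) =
      last (dirVec v) ^ (k + 1) * u (a, v) := by
  rw [scaledData, direction_bar_div_last]

/-- The moment `J_m(ā, ξ̄) = ∫ (p̄ · ξ̄)^m w(ā, p̄) dp̄`. -/
def moment {d : ℕ} (w : E d → E d → ℝ) (m : ℕ) (a ξ : E d) : ℝ :=
  ∫ p : E d, (inner ℝ p ξ) ^ m * w a p

/-- `c m j`, `0 ≤ j ≤ m`, are homogeneous polynomials of degree `m - j` with
`J_m(ā, ξ̄) = ∑_{j ≤ m} c_{m,j}(ξ̄) (ā · ξ̄)^j`. -/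
def IsMomentCoeff {d : ℕ} (w : E d → E d → ℝ) (c : ℕ → ℕ → MvPolynomial (Fin d) ℝ) : Prop :=
  ∀ m : ℕ, (∀ j ≤ m, (c m j).IsHomogeneous (m - j)) ∧
    ∀ a ξ : E d, moment w m a ξ =
      ∑ j ∈ Finset.range (m + 1), MvPolynomial.eval (fun i => ξ i) (c m j) * (inner ℝ a ξ) ^ j

/-- The term of index `m = j + l` of the series `Q_j(ξ̄) = ∑_{m ≥ j} (-i)^m / m! c_{m,j}(ξ̄)`,
at a complex point `ξ̄`. -/
def qTerm {d : ℕ} (c : ℕ → ℕ → MvPolynomial (Fin d) ℝ) (j : ℕ)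
    (ξ : EuclideanSpace ℂ (Fin d)) (l : ℕ) : ℂ :=
  (-Complex.I) ^ (j + l) / ((j + l).factorial : ℂ) *
    MvPolynomial.aeval (fun i => ξ i) (c (j + l) j)

/-- `Q_j(ξ̄) = ∑_{m ≥ j} (-i)^m / m! c_{m,j}(ξ̄)`. -/
def Q {d : ℕ} (c : ℕ → ℕ → MvPolynomial (Fin d) ℝ) (j : ℕ)
    (ξ : EuclideanSpace ℂ (Fin d)) : ℂ :=
  ∑' l : ℕ, qTerm c j ξ l

/-- The power series `∑_j Q_j(ξ̄) σ^j` converges on `ℂ × ℂ^{n-1}` to the entire function `H`. -/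
def IsEntireSum {d : ℕ} (c : ℕ → ℕ → MvPolynomial (Fin d) ℝ)
    (H : ℂ × EuclideanSpace ℂ (Fin d) → ℂ) : Prop :=
  Differentiable ℂ H ∧ ∀ (σ : ℂ) (ξ : EuclideanSpace ℂ (Fin d)),
    (∀ j, Summable (qTerm c j ξ)) ∧ HasSum (fun j => Q c j ξ * σ ^ j) (H (σ, ξ))

/-- The imaginary part of a vector of `ℂ^{n-1}`. -/
def imVec {d : ℕ} (ξ : EuclideanSpace ℂ (Fin d)) : E d := WithLp.toLp 2 (fun i => (ξ i).im)

/-- The Paley–Wiener bound for the convex set `{t ∈ [-M₀, -m₀], |p̄| ≤ -R t}`. -/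
def PaleyWienerBound {d : ℕ} (m₀ M₀ R : ℝ) (H : ℂ × EuclideanSpace ℂ (Fin d) → ℂ) : Prop :=
  ∀ N : ℕ, ∃ C : ℝ, 0 < C ∧ ∀ (σ : ℂ) (ξ : EuclideanSpace ℂ (Fin d)),
    ‖H (σ, ξ)‖ ≤ C * (1 + ‖σ‖ + ‖ξ‖) ^ (-(N : ℤ)) *
      Real.exp (max (-m₀ * (σ.im - R * ‖imVec ξ‖)) (-M₀ * (σ.im - R * ‖imVec ξ‖)))

end DivergentBeam

end

/-!
The proof replaces the density `f` by its image under a projective involution of the half-space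
and reduces the statement to a Paley–Wiener theorem for the Fourier transform on `ℝ^n`.

In the variable `t = r v_n` the scaled data are `w(a, p) = ∫_0^∞ f(a + t p, t) t^k dt`. Put
`f(y, t) = t^{-(k+2)} g(y / t, 1 / t)`. The map `(y, t) ↦ (y / t, 1 / t)` is an involution of
`{x_n > 0}`, so `g` is again an arbitrary test function on the half-space (`IsTestFunction.inversion`),
and the substitution `s = 1 / t` turns the data into unweighted integrals over parallel lines,
`w(a, p) = ∫ g(p + s a, s) ds` (`exists_beamTransform_iff`). By a sheared form of Fubini's
theorem, `∫ φ(p) w(a, p) dp = ∫ φ(x̄ - x_n a) g(x) dx` for every weight `φ`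
(`integral_mul_integral_line`).

For necessity, the weight `(p · ξ)^m` gives the moment polynomials by the binomial theorem, and
summing the exponential series gives `H(σ, ξ) = ∫ e^{-i (x̄ · ξ - x_n σ)} g(x) dx`. The support of
`g` lies in a cone `{m₀ ≤ x_n ≤ M₀, |x̄| ≤ R x_n}`, whose support function is the exponent in the
Paley–Wiener bound; the polynomial decay comes from integrating by parts, by induction on the
order (`exists_freqSize_pow_mul_le`).

For sufficiency, Cauchy's estimates for `(σ, λ) ↦ H(σ, λ ξ)` show that the iterated series
defining `H` is an absolutely convergent double series (`hasSum_prod_of_entire`). Rearranged by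
total degree, it is the moment expansion of the Fourier transform of `w(a, ·)`, which is therefore
`H(a · ξ, ξ)` (`integral_exp_mul_eq_of_isEntireSum`). Let `g` be the inverse Fourier transform of
`H` on real frequencies. It is smooth by the decay of `H`. It vanishes off the cone because the
inversion integral at frequencies shifted by `τ η` is entire in `τ` and invariant under real
translations of `τ`, hence constant (`integral_shiftKernel_eq`), while it decays exponentially as
`τ = i T`, `T → ∞`, when `η` separates the point from the cone. Finally `w(a, ·)` and the line
integrals of `g` have the same Fourier transform, hence coincide (`eq_integral_line_fourierInv`).
-/

noncomputable section

namespace DivergentBeam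

open MeasureTheory Set

/-! ### Coordinates and a sheared Fubini theorem -/

@[simp] lemma bar_mk {d : ℕ} (p : E d) (t : ℝ) : bar (mk p t) = p := by
  ext i; simp [bar, mk]

@[simp] lemma last_mk {d : ℕ} (p : E d) (t : ℝ) : last (mk p t) = t := by
  simp [last, mk]

@[simp] lemma mk_bar_last {d : ℕ} (x : E (d + 1)) : mk (bar x) (last x) = x := by
  ext i
  refine Fin.lastCases ?_ (fun i => ?_) i <;> simp [mk, bar, last]

/-- The splitting `x ↦ (x_n, x̄)` as a continuous linear equivalence. -/
def splitCLE (d : ℕ) : E (d + 1) ≃L[ℝ] ℝ × E d :=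
  LinearEquiv.toContinuousLinearEquiv
    { toFun := fun x => (last x, bar x)
      invFun := fun z => mk z.2 z.1
      map_add' := fun x y => by
        refine Prod.ext rfl ?_
        ext i; simp [bar]
      map_smul' := fun r x => by
        refine Prod.ext rfl ?_
        ext i; simp [bar]
      left_inv := fun x => mk_bar_last x
      right_inv := fun z => by simp }

lemma contDiff_last {d : ℕ} : ContDiff ℝ ∞ (last (d := d)) :=
  (ContinuousLinearMap.fst ℝ ℝ (E d) ∘L (splitCLE d : E (d + 1) →L[ℝ] ℝ × E d)).contDiff

lemma contDiff_bar {d : ℕ} : ContDiff ℝ ∞ (bar (d := d)) :=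
  (ContinuousLinearMap.snd ℝ ℝ (E d) ∘L (splitCLE d : E (d + 1) →L[ℝ] ℝ × E d)).contDiff

lemma contDiff_mk {d : ℕ} : ContDiff ℝ ∞ fun z : ℝ × E d => mk z.2 z.1 :=
  (splitCLE d).symm.contDiff

lemma continuous_last {d : ℕ} : Continuous (last (d := d)) := contDiff_last.continuous

lemma continuous_bar {d : ℕ} : Continuous (bar (d := d)) := contDiff_bar.continuous

@[fun_prop]
lemma _root_.Continuous.divergentBeam_last {d : ℕ} {X : Type*} [TopologicalSpace X]
    {f : X → E (d + 1)} (hf : Continuous f) : Continuous fun x => last (f x) :=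
  continuous_last.comp hf

@[fun_prop]
lemma _root_.Continuous.divergentBeam_bar {d : ℕ} {X : Type*} [TopologicalSpace X]
    {f : X → E (d + 1)} (hf : Continuous f) : Continuous fun x => bar (f x) :=
  continuous_bar.comp hf

@[fun_prop]
lemma _root_.Continuous.divergentBeam_mk {d : ℕ} {X : Type*} [TopologicalSpace X]
    {f : X → E d} {g : X → ℝ} (hf : Continuous f) (hg : Continuous g) :
    Continuous fun x => mk (f x) (g x) :=
  contDiff_mk.continuous.comp (hg.prodMk hf)

lemma last_add {d : ℕ} (x y : E (d + 1)) : last (x + y) = last x + last y := rfl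

lemma bar_add {d : ℕ} (x y : E (d + 1)) : bar (x + y) = bar x + bar y :=
  congrArg Prod.snd ((splitCLE d).map_add x y)

lemma last_smul {d : ℕ} (r : ℝ) (x : E (d + 1)) : last (r • x) = r * last x := rfl

lemma bar_smul {d : ℕ} (r : ℝ) (x : E (d + 1)) : bar (r • x) = r • bar x :=
  congrArg Prod.snd ((splitCLE d).map_smul r x)

lemma inner_eq_bar_last {d : ℕ} (x y : E (d + 1)) :
    inner ℝ x y = inner ℝ (bar x) (bar y) + last x * last y := by
  simp [PiLp.inner_apply, Fin.sum_univ_castSucc, bar, last, mul_comm]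

lemma norm_mk_le {d : ℕ} (p : E d) (t : ℝ) : ‖mk p t‖ ≤ ‖p‖ + |t| := by
  refine le_of_sq_le_sq ?_ (by positivity)
  rw [norm_sq_mk]
  nlinarith [sq_abs t, mul_nonneg (norm_nonneg p) (abs_nonneg t)]

lemma measurePreserving_mk (d : ℕ) :
    MeasurePreserving (fun z : ℝ × E d => mk z.2 z.1) := by
  have h1 : MeasurePreserving (fun z : ℝ × E d => (z.1, WithLp.ofLp z.2)) :=
    (MeasurePreserving.id volume).prod (PiLp.volume_preserving_ofLp (Fin d))
  have h2 := (volume_preserving_piFinSuccAbove (fun _ : Fin (d + 1) => ℝ) (Fin.last d)).symm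
  have h3 := PiLp.volume_preserving_toLp (Fin (d + 1))
  have h := (h3.comp h2).comp h1
  convert h using 1
  ext z i
  refine Fin.lastCases ?_ (fun i => ?_) i
  · simp [mk, MeasurableEquiv.piFinSuccAbove, Fin.insertNthEquiv]
  · simp [mk, MeasurableEquiv.piFinSuccAbove, Fin.insertNthEquiv]

/-- The volume-preserving homeomorphism `(s, p) ↦ (p + s a, s)`: it carries the slices with `p`
fixed to the lines in direction `(a, 1)`. -/
def shear {d : ℕ} (a : E d) : ℝ × E d ≃ₜ E (d + 1) where
  toFun z := mk (z.2 + z.1 • a) z.1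
  invFun x := (last x, bar x - last x • a)
  left_inv z := by simp
  right_inv x := by simp
  continuous_toFun := by fun_prop
  continuous_invFun := by fun_prop

lemma shear_apply {d : ℕ} (a : E d) (z : ℝ × E d) : shear a z = mk (z.2 + z.1 • a) z.1 := rfl

lemma measurePreserving_shear {d : ℕ} (a : E d) : MeasurePreserving (shear a) := by
  have h : MeasurePreserving (fun z : ℝ × E d => (z.1, z.2 + z.1 • a)) :=
    (MeasurePreserving.id volume).skew_product (g := fun s p => p + s • a)
      (by fun_prop) (.of_forall fun s => (measurePreserving_add_right volume (s • a)).map_eq)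
  exact (measurePreserving_mk d).comp h

/-- Integrating line integrals in direction `(a, 1)` against a weight in the transverse variable
is a single integral over the whole space. -/
lemma integral_mul_integral_line {d : ℕ} (a : E d) {φ : E d → ℂ} (hφ : Continuous φ)
    {g : E (d + 1) → ℂ} (hg : Continuous g) (hgc : HasCompactSupport g) :
    ∫ p, φ p * ∫ s, g (mk (p + s • a) s) = ∫ x, φ (bar x - last x • a) * g x := by
  set G : E (d + 1) → ℂ := fun x => φ (bar x - last x • a) * g x
  have hG : Continuous G := by fun_prop
  have hGc : HasCompactSupport G := hgc.mul_left
  have hcomp : ∀ s p, G (shear a (s, p)) = φ p * g (mk (p + s • a) s) := by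
    intro s p
    simp [G, shear_apply]
  have hint : Integrable (fun z => G (shear a z)) :=
    ((hG.comp (shear a).continuous).integrable_of_hasCompactSupport
      (hGc.comp_homeomorph (shear a)))
  rw [← (measurePreserving_shear a).integral_comp (shear a).measurableEmbedding]
  change _ = ∫ z, G (shear a z) ∂(volume.prod volume)
  rw [integral_prod_symm _ hint]
  simp only [hcomp, integral_const_mul]

/-- Line integrals of a compactly supported continuous function depend continuously on the line. -/
lemma continuous_integral_line {d : ℕ} (a : E d) {g : E (d + 1) → ℂ} (hg : Continuous g)
    (hgc : HasCompactSupport g) : Continuous fun p => ∫ s, g (mk (p + s • a) s) := by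
  have hK : IsCompact (last '' tsupport g) := IsCompact.image hgc continuous_last
  have : ∀ p, ∫ s, g (mk (p + s • a) s) = ∫ s in last '' tsupport g, g (mk (p + s • a) s) := by
    intro p
    refine (setIntegral_eq_integral_of_forall_compl_eq_zero fun s hs => ?_).symm
    refine image_eq_zero_of_notMem_tsupport fun h => hs ⟨_, h, last_mk _ _⟩
  simp only [this]
  exact continuous_parametric_integral_of_continuous (by fun_prop) hK

/-! ### The truncated cones -/

/-- The truncated cone `{m ≤ x_n ≤ M, |x̄| ≤ R x_n}`, compact when `0 ≤ R`. -/
def truncCone (d : ℕ) (m M R : ℝ) : Set (E (d + 1)) :=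
  {x | m ≤ last x ∧ last x ≤ M ∧ ‖bar x‖ ≤ R * last x}

lemma isCompact_truncCone (d : ℕ) {m M R : ℝ} (hR : 0 ≤ R) : IsCompact (truncCone d m M R) := by
  refine Metric.isCompact_of_isClosed_isBounded ?_ ?_
  · refine (isClosed_le continuous_const continuous_last).inter
      ((isClosed_le continuous_last continuous_const).inter
        (isClosed_le continuous_bar.norm (continuous_const.mul continuous_last)))
  · refine (Metric.isBounded_closedBall (x := (0 : E (d + 1)))
      (r := R * M + max |m| |M|)).subset fun x hx => ?_
    obtain ⟨h1, h2, h3⟩ := hx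
    rw [mem_closedBall_zero_iff, ← mk_bar_last x]
    refine (norm_mk_le _ _).trans (add_le_add ?_ (abs_le_max_abs_abs h1 h2))
    exact h3.trans (mul_le_mul_of_nonneg_left h2 hR)

lemma isTestFunction_of_support_subset {d : ℕ} {F : E (d + 1) → ℝ} {m M R : ℝ}
    (hF : ContDiff ℝ ∞ F) (hm : 0 < m) (hR : 0 ≤ R)
    (h : Function.support F ⊆ truncCone d m M R) : IsTestFunction F := by
  have hK := isCompact_truncCone d (m := m) (M := M) hR
  refine ⟨hF, HasCompactSupport.of_support_subset_isCompact hK h, ?_⟩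
  exact (closure_minimal h hK.isClosed).trans fun x hx => hm.trans_le hx.1

/-- A test function of the half-space lives in some truncated cone, as its support is compact and
keeps a positive distance from `{x_n = 0}`. -/
lemma IsTestFunction.exists_support_subset {d : ℕ} {F : E (d + 1) → ℝ} (hF : IsTestFunction F) :
    ∃ m M R, 0 < m ∧ m < M ∧ 0 < R ∧ Function.support F ⊆ truncCone d m M R := by
  obtain ⟨-, hc, hs⟩ := hF
  by_cases hne : (tsupport F).Nonempty
  · obtain ⟨x₀, hx₀, hmin⟩ := IsCompact.exists_isMinOn hc hne continuous_last.continuousOn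
    obtain ⟨x₁, hx₁, hmax⟩ := IsCompact.exists_isMaxOn hc hne continuous_last.continuousOn
    obtain ⟨x₂, hx₂, hbar⟩ := IsCompact.exists_isMaxOn hc hne continuous_bar.norm.continuousOn
    have h0 : 0 < last x₀ := hs hx₀
    -- The summands `1` make `m < M` and `0 < R` strict.
    refine ⟨last x₀, last x₁ + 1, (‖bar x₂‖ + 1) / last x₀, h0, ?_, by positivity, ?_⟩
    · linarith [isMinOn_iff.1 hmin _ hx₁]
    · intro x hx
      have hx := subset_tsupport F hx
      have h1 := isMinOn_iff.1 hmin _ hx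
      have h2 := isMaxOn_iff.1 hmax _ hx
      have h3 := isMaxOn_iff.1 hbar _ hx
      refine ⟨h1, by linarith, ?_⟩
      rw [div_mul_eq_mul_div, le_div_iff₀ h0]
      nlinarith [norm_nonneg (bar x), norm_nonneg (bar x₂)]
  · refine ⟨1, 2, 1, one_pos, one_lt_two, one_pos, fun x hx => ?_⟩
    exact absurd ⟨x, subset_tsupport F hx⟩ hne

/-! ### The projective inversion of the half-space -/

/-- The weighted pull-back `x ↦ x_n^α F(x̄ / x_n, 1 / x_n)` by the projective involution of the
half-space `{x_n > 0}`, extended by `0`. -/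
def inversion {d : ℕ} (α : ℤ) (F : E (d + 1) → ℝ) (x : E (d + 1)) : ℝ :=
  if 0 < last x then last x ^ α * F (mk ((last x)⁻¹ • bar x) (last x)⁻¹) else 0

lemma inversion_of_pos {d : ℕ} {α : ℤ} {F : E (d + 1) → ℝ} {x : E (d + 1)} (hx : 0 < last x) :
    inversion α F x = last x ^ α * F (mk ((last x)⁻¹ • bar x) (last x)⁻¹) := if_pos hx

lemma inversion_inversion {d : ℕ} {α : ℤ} {F : E (d + 1) → ℝ} {x : E (d + 1)} (hx : 0 < last x) :
    inversion α (inversion α F) x = F x := by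
  rw [inversion_of_pos hx, inversion_of_pos (by simpa using hx)]
  have : last x ≠ 0 := hx.ne'
  simp [smul_smul, this, zpow_ne_zero α this]

/-- The involution maps truncated cones into truncated cones. -/
lemma inversion_support_subset {d : ℕ} {α : ℤ} {F : E (d + 1) → ℝ} {m M R : ℝ} (hm : 0 < m)
    (hM : 0 < M) (hR : 0 < R) (h : Function.support F ⊆ truncCone d m M R) :
    Function.support (inversion α F) ⊆ truncCone d M⁻¹ m⁻¹ (R * M) := by
  intro x hx
  have hpos : 0 < last x := by
    by_contra hneg
    exact hx (if_neg hneg)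
  rw [Function.mem_support, inversion_of_pos hpos] at hx
  obtain ⟨h1, h2, h3⟩ := h (right_ne_zero_of_mul hx)
  simp only [last_mk, bar_mk, norm_smul, norm_inv, Real.norm_of_nonneg hpos.le] at h1 h2 h3
  have h4 : M⁻¹ ≤ last x := inv_le_of_inv_le₀ hpos h2
  refine ⟨h4, (le_inv_comm₀ hm hpos).1 h1, ?_⟩
  have h5 : ‖bar x‖ ≤ R := by
    rwa [mul_comm R, mul_le_mul_iff_of_pos_left (inv_pos.2 hpos)] at h3
  have h6 : 1 ≤ M * last x := by
    rwa [inv_le_iff_one_le_mul₀ hM, mul_comm] at h4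
  nlinarith

/-- No singularity appears at `{x_n = 0}`: the inverted function vanishes where `x_n` is smaller
than the reciprocal of the height of the support. -/
lemma IsTestFunction.inversion {d : ℕ} {F : E (d + 1) → ℝ} (hF : IsTestFunction F) (α : ℤ) :
    IsTestFunction (inversion α F) := by
  obtain ⟨m, M, R, hm, hmM, hR, hs⟩ := hF.exists_support_subset
  have hM := hm.trans hmM
  have hsupp := inversion_support_subset (α := α) hm hM hR hs
  refine isTestFunction_of_support_subset ?_ (inv_pos.2 hM) (by positivity) hsupp
  rw [contDiff_iff_contDiffAt]
  intro x
  by_cases hx : 0 < last x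
  · have hev : ∀ᶠ y in nhds x, 0 < last y := continuous_last.continuousAt.eventually_const_lt hx
    refine ContDiffAt.congr_of_eventuallyEq ?_
      (hev.mono fun y hy => inversion_of_pos (α := α) (F := F) hy)
    have hl : ContDiffAt ℝ ∞ (last (d := d)) x := contDiff_last.contDiffAt
    have hli : ContDiffAt ℝ ∞ (fun y : E (d + 1) => (last y)⁻¹) x := hl.inv hx.ne'
    have hz : ContDiffAt ℝ ∞ (fun y : E (d + 1) => last y ^ α) x := by
      cases α with
      | ofNat n => simpa using hl.pow n
      | negSucc n => exact (hl.pow (n + 1)).inv (pow_pos hx _).ne'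
    refine hz.mul (hF.1.contDiffAt.comp x ?_)
    exact contDiff_mk.contDiffAt.comp x (hli.prodMk (hli.smul contDiff_bar.contDiffAt))
  · have hev : ∀ᶠ y in nhds x, last y < M⁻¹ :=
      continuous_last.continuousAt.eventually_lt_const
        (lt_of_le_of_lt (not_lt.1 hx) (inv_pos.2 hM))
    refine (contDiffAt_const (c := (0 : ℝ))).congr_of_eventuallyEq (hev.mono fun y hy => ?_)
    by_contra hne
    exact absurd (hsupp hne).1 (not_le.2 hy)

/-! ### The beam transform as an integral over parallel lines -/

/-- In projective coordinates the scaled beam transform integrates over `t = r v_n`. -/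
lemma last_pow_mul_beamTransform {d : ℕ} (k : ℕ) (f : E (d + 1) → ℝ) (a : E d)
    {v : E (d + 1)} (hv : 0 < last v) :
    last v ^ (k + 1) * beamTransform k f (mk a 0) v =
      ∫ t in Ioi (0 : ℝ), f (mk (a + t • (last v)⁻¹ • bar v) t) * t ^ k := by
  have h := integral_comp_mul_left_Ioi
    (fun t => f (mk (a + t • (last v)⁻¹ • bar v) t) * t ^ k) 0 hv
  rw [mul_zero] at h
  have hne := hv.ne'
  rw [eq_comm, inv_smul_eq_iff₀ hne] at h
  rw [h, beamTransform, pow_succ', mul_assoc, smul_eq_mul, ← integral_const_mul]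
  congr 1
  refine setIntegral_congr_fun measurableSet_Ioi fun r _ => ?_
  have hpt : mk a 0 + r • v = mk (a + (last v * r) • (last v)⁻¹ • bar v) (last v * r) := by
    rw [← mk_bar_last (mk a 0 + r • v)]
    simp only [bar_add, last_add, bar_smul, last_smul, bar_mk, last_mk, zero_add, smul_smul]
    rw [mul_comm (last v) r, mul_assoc, mul_inv_cancel₀ hne, mul_one]
  simp only [hpt, mul_pow]
  ring

/-- After the inversion `s = 1 / t`, the integral over the rays through `(a, 0)` becomes an
unweighted integral over the parallel lines in direction `(a, 1)`. -/
lemma integral_ray_inversion {d : ℕ} (k : ℕ) {g : E (d + 1) → ℝ}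
    (hg : IsTestFunction g) (a p : E d) :
    ∫ t in Ioi (0 : ℝ), inversion (-(k + 2 : ℤ)) g (mk (a + t • p) t) * t ^ k =
      ∫ s, g (mk (p + s • a) s) := by
  have h1 : ∫ s, g (mk (p + s • a) s) = ∫ s in Ioi (0 : ℝ), g (mk (p + s • a) s) := by
    refine (setIntegral_eq_integral_of_forall_compl_eq_zero fun s hs => ?_).symm
    refine image_eq_zero_of_notMem_tsupport fun h => hs ?_
    simpa using hg.2.2 h
  rw [h1, ← integral_comp_rpow_Ioi (fun s => g (mk (p + s • a) s)) (neg_ne_zero.2 one_ne_zero)]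
  refine setIntegral_congr_fun measurableSet_Ioi fun t (ht : 0 < t) => ?_
  have ht' := ht.ne'
  have hpow : t ^ (-(k + 2 : ℤ)) * t ^ k = t ^ (-2 : ℤ) := by
    rw [← zpow_natCast t k, ← zpow_add₀ ht']
    congr 1
    ring
  have hrp : t ^ ((-1 : ℝ) - 1) = t ^ (-2 : ℤ) := by
    rw [← Real.rpow_intCast]; norm_num
  simp only [inversion_of_pos (x := mk (a + t • p) t) (by simpa using ht), last_mk, bar_mk,
    Real.rpow_neg_one, hrp, abs_neg, abs_one, one_mul, smul_eq_mul, smul_add, smul_smul,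
    inv_mul_cancel₀ ht', one_smul]
  rw [mul_right_comm, hpow, add_comm p]

lemma last_dirVec_direction_pos {d : ℕ} (p : E d) : 0 < last (dirVec (direction p)) :=
  (direction p).2

lemma inv_last_smul_bar_direction {d : ℕ} (p : E d) :
    (last (dirVec (direction p)))⁻¹ • bar (dirVec (direction p)) = p := by
  have h := norm_mk_one_pos p
  change (last (‖mk p 1‖⁻¹ • mk p 1))⁻¹ • bar (‖mk p 1‖⁻¹ • mk p 1) = p
  rw [last_smul, bar_smul, last_mk, bar_mk, mul_one, smul_smul, inv_mul_cancel₀ (by positivity),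
    one_smul]

lemma scaledData_eq_iff_forall_direction {d : ℕ} (k : ℕ)
    (u : E d × upperHemisphere d → ℝ) (f : E (d + 1) → ℝ) :
    (∀ a v, u (a, v) = beamTransform k f (mk a 0) (dirVec v)) ↔
      ∀ a p, scaledData k u a p = ∫ t in Ioi (0 : ℝ), f (mk (a + t • p) t) * t ^ k := by
  constructor
  · intro h a p
    rw [scaledData, h, last_pow_mul_beamTransform k f a (last_dirVec_direction_pos p),
      inv_last_smul_bar_direction]
  · intro h a v
    have hv : 0 < last (dirVec v) := v.2
    have h1 := h a ((last (dirVec v))⁻¹ • bar (dirVec v))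
    rw [scaledData_bar_div_last, ← last_pow_mul_beamTransform k f a hv] at h1
    exact mul_left_cancel₀ (pow_pos hv _).ne' h1

/-- The range of the beam transform, in terms of the inverted density `g`. -/
lemma exists_beamTransform_iff {d : ℕ} (k : ℕ) (u : E d × upperHemisphere d → ℝ) :
    (∃ f : E (d + 1) → ℝ, IsTestFunction f ∧
      ∀ a v, u (a, v) = beamTransform k f (mk a 0) (dirVec v)) ↔
    ∃ g : E (d + 1) → ℝ, IsTestFunction g ∧
      ∀ a p, scaledData k u a p = ∫ s, g (mk (p + s • a) s) := by
  simp only [scaledData_eq_iff_forall_direction]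
  constructor
  · rintro ⟨f, hf, h⟩
    have hg := hf.inversion (-(k + 2 : ℤ))
    refine ⟨_, hg, fun a p => ?_⟩
    rw [h, ← integral_ray_inversion k hg]
    refine setIntegral_congr_fun measurableSet_Ioi fun t (ht : 0 < t) => ?_
    rw [inversion_inversion (by simpa using ht)]
  · rintro ⟨g, hg, h⟩
    exact ⟨_, hg.inversion _, fun a p => by rw [h, integral_ray_inversion k hg]⟩

lemma continuous_direction {d : ℕ} : Continuous (direction (d := d)) := by
  refine Continuous.subtype_mk (Continuous.subtype_mk ?_ _) _
  have : Continuous fun p : E d => mk p 1 := by fun_prop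
  exact (this.norm.inv₀ fun p => (norm_mk_one_pos p).ne').smul this

lemma continuous_scaledData {d : ℕ} (k : ℕ) {u : E d × upperHemisphere d → ℝ}
    (hu : SmoothData u) (a : E d) : Continuous (scaledData k u a) := by
  have h1 : Continuous fun p : E d => last (dirVec (direction p)) :=
    continuous_last.comp (continuous_subtype_val.comp
      (continuous_subtype_val.comp continuous_direction))
  have h2 : Continuous fun p : E d => u (a, direction p) :=
    hu.continuous.comp (continuous_const.prodMk continuous_direction)
  exact (h1.pow _).mul h2

/-! ### The Fourier–Laplace transform -/

/-- The pairing `x̄ · ξ̄ - x_n σ` of a real point `x` with a complex frequency `(σ, ξ̄)`. -/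
def pairing {d : ℕ} (x : E (d + 1)) (ζ : ℂ × EuclideanSpace ℂ (Fin d)) : ℂ :=
  ∑ i, ζ.2 i * (bar x i : ℂ) - ζ.1 * (last x : ℂ)

/-- The pairing as a linear form in the frequency. -/
def pairingL {d : ℕ} (x : E (d + 1)) : ℂ × EuclideanSpace ℂ (Fin d) →L[ℂ] ℂ :=
  ∑ i, (bar x i : ℂ) • (EuclideanSpace.proj i ∘L ContinuousLinearMap.snd ℂ ℂ _) -
    (last x : ℂ) • ContinuousLinearMap.fst ℂ ℂ _

lemma pairingL_apply {d : ℕ} (x : E (d + 1)) (ζ : ℂ × EuclideanSpace ℂ (Fin d)) :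
    pairingL x ζ = pairing x ζ := by
  simp [pairingL, pairing, mul_comm]

/-- The pairing as a linear form in the space variable. -/
def pairingR {d : ℕ} (ζ : ℂ × EuclideanSpace ℂ (Fin d)) : E (d + 1) →L[ℝ] ℂ :=
  LinearMap.toContinuousLinearMap
    { toFun := fun x => pairing x ζ
      map_add' := fun x y => by
        simp [pairing, bar_add, last_add, mul_add, Finset.sum_add_distrib]
        ring
      map_smul' := fun r x => by
        simp only [pairing, bar_smul, last_smul, PiLp.smul_apply, smul_eq_mul, Complex.ofReal_mul,
          RingHom.id_apply, Complex.real_smul, mul_sub, Finset.mul_sum]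
        congr 1
        · exact Finset.sum_congr rfl fun i _ => by ring
        · ring }

lemma pairingR_apply {d : ℕ} (x : E (d + 1)) (ζ : ℂ × EuclideanSpace ℂ (Fin d)) :
    pairingR ζ x = pairing x ζ := rfl

lemma continuous_pairingL {d : ℕ} : Continuous (pairingL (d := d)) := by
  unfold pairingL
  fun_prop

lemma continuous_pairing {d : ℕ} :
    Continuous fun z : E (d + 1) × (ℂ × EuclideanSpace ℂ (Fin d)) => pairing z.1 z.2 := by
  unfold pairing
  fun_prop

lemma continuous_pairing_left {d : ℕ} (ζ : ℂ × EuclideanSpace ℂ (Fin d)) :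
    Continuous fun x => pairing x ζ := (pairingR ζ).continuous

lemma im_pairing {d : ℕ} (x : E (d + 1)) (ζ : ℂ × EuclideanSpace ℂ (Fin d)) :
    (pairing x ζ).im = inner ℝ (bar x) (imVec ζ.2) - last x * ζ.1.im := by
  simp [pairing, PiLp.inner_apply, imVec, mul_comm]

/-- The Fourier–Laplace transform `∫ e^{-i (x̄ · ξ̄ - x_n σ)} g(x) dx`. -/
def fourierLaplace {d : ℕ} (g : E (d + 1) → ℂ) (ζ : ℂ × EuclideanSpace ℂ (Fin d)) : ℂ :=
  ∫ x, Complex.exp (-Complex.I * pairing x ζ) * g x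

lemma differentiable_fourierLaplace {d : ℕ} {g : E (d + 1) → ℂ} (hg : Continuous g)
    (hgc : HasCompactSupport g) : Differentiable ℂ (fourierLaplace g) := by
  intro ζ₀
  have hK : IsCompact (tsupport g ×ˢ Metric.closedBall ζ₀ 1) :=
    IsCompact.prod hgc (isCompact_closedBall ζ₀ 1)
  set D : E (d + 1) → ℂ × EuclideanSpace ℂ (Fin d) → (ℂ × EuclideanSpace ℂ (Fin d) →L[ℂ] ℂ) :=
    fun x ζ => Complex.exp (-Complex.I * pairing x ζ) • (-Complex.I) • pairingL x
  have hDc : Continuous fun z : E (d + 1) × (ℂ × EuclideanSpace ℂ (Fin d)) => D z.1 z.2 :=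
    (Complex.continuous_exp.comp (continuous_const.mul continuous_pairing)).smul
      ((continuous_pairingL.comp continuous_fst).const_smul (-Complex.I))
  obtain ⟨C, hC⟩ := hK.exists_bound_of_continuousOn hDc.continuousOn
  have hexp : ∀ ζ, Continuous fun x => Complex.exp (-Complex.I * pairing x ζ) * g x := fun ζ =>
    (Complex.continuous_exp.comp (continuous_const.mul (continuous_pairing_left ζ))).mul hg
  refine (hasFDerivAt_integral_of_dominated_of_fderiv_le
    (F := fun ζ x => Complex.exp (-Complex.I * pairing x ζ) * g x)
    (F' := fun ζ x => g x • D x ζ) (bound := fun x => ‖g x‖ * C)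
    (Metric.ball_mem_nhds ζ₀ one_pos) ?_ ?_ ?_ ?_ ?_ ?_).differentiableAt
  · exact .of_forall fun ζ => (hexp ζ).aestronglyMeasurable
  · exact (hexp ζ₀).integrable_of_hasCompactSupport hgc.mul_left
  · exact (hg.smul (hDc.comp (continuous_id.prodMk continuous_const))).aestronglyMeasurable
  · refine .of_forall fun x ζ hζ => ?_
    rw [norm_smul]
    by_cases hx : x ∈ tsupport g
    · exact mul_le_mul_of_nonneg_left (hC (x, ζ) ⟨hx, Metric.ball_subset_closedBall hζ⟩)
        (norm_nonneg _)
    · simp [image_eq_zero_of_notMem_tsupport hx]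
  · exact ((hg.norm.mul continuous_const).integrable_of_hasCompactSupport hgc.norm.mul_right)
  · refine .of_forall fun x ζ _ => ?_
    have h1 : HasFDerivAt (fun ζ => -Complex.I * pairing x ζ) ((-Complex.I) • pairingL x) ζ := by
      simpa only [pairingL_apply] using (pairingL x).hasFDerivAt.const_mul (-Complex.I)
    simpa [D] using h1.cexp.mul_const (g x)

/-- The term-by-term integration of an exponential series against a compactly supported density. -/
lemma hasSum_integral_exp_series {X : Type*} [TopologicalSpace X] [MeasurableSpace X]
    [OpensMeasurableSpace X] [SecondCountableTopology X] {μ : Measure X}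
    [IsFiniteMeasureOnCompacts μ]
    {A h : X → ℂ} (hA : Continuous A) (hh : Continuous h) (hhc : HasCompactSupport h) :
    HasSum (fun l : ℕ => ∫ x, A x ^ l / (l.factorial : ℂ) * h x ∂μ)
      (∫ x, Complex.exp (A x) * h x ∂μ) := by
  refine hasSum_integral_of_dominated_convergence
    (fun l x => ‖A x‖ ^ l / (l.factorial : ℝ) * ‖h x‖) (fun l => ?_) (fun l => ?_) ?_ ?_ ?_
  · exact (((hA.pow l).div_const _).mul hh).aestronglyMeasurable
  · exact .of_forall fun x => by simp
  · exact .of_forall fun x => (Real.summable_pow_div_factorial _).mul_right _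
  · have : ∀ x, ∑' l : ℕ, ‖A x‖ ^ l / (l.factorial : ℝ) * ‖h x‖ = Real.exp ‖A x‖ * ‖h x‖ := by
      intro x
      rw [tsum_mul_right, Real.exp_eq_exp_ℝ, NormedSpace.exp_eq_tsum_div]
    simp only [this]
    exact ((Real.continuous_exp.comp hA.norm).mul hh.norm).integrable_of_hasCompactSupport
      hhc.norm.mul_left
  · refine .of_forall fun x => HasSum.mul_right _ ?_
    rw [Complex.exp_eq_exp_ℂ]
    exact NormedSpace.expSeries_div_hasSum_exp (A x)

/-! ### Moment polynomials -/

/-- The polynomial `binom(m, j) ∫ (-x_n)^j (x̄ · ξ̄)^{m-j} g(x) dx` in `ξ̄`, with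
`(x̄ · ξ̄)^{m-j}` expanded over words of length `m - j` in the coordinates. -/
def momentPoly {d : ℕ} (g : E (d + 1) → ℝ) (m j : ℕ) : MvPolynomial (Fin d) ℝ :=
  MvPolynomial.C (m.choose j : ℝ) * ∑ φ : Fin (m - j) → Fin d,
    MvPolynomial.C (∫ x, (-last x) ^ j * (∏ i, bar x (φ i)) * g x) * ∏ i, MvPolynomial.X (φ i)

lemma isHomogeneous_momentPoly {d : ℕ} (g : E (d + 1) → ℝ) (m j : ℕ) :
    (momentPoly g m j).IsHomogeneous (m - j) := by
  refine MvPolynomial.IsHomogeneous.C_mul (MvPolynomial.IsHomogeneous.sum _ _ _ fun φ _ => ?_) _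
  refine MvPolynomial.IsHomogeneous.C_mul ?_ _
  simpa using MvPolynomial.IsHomogeneous.prod Finset.univ
    (fun i => (MvPolynomial.X (φ i) : MvPolynomial (Fin d) ℝ)) (fun _ => 1)
    fun i _ => MvPolynomial.isHomogeneous_X ℝ (φ i)

lemma aeval_momentPoly {d : ℕ} {g : E (d + 1) → ℝ} (hg : Continuous g)
    (hgc : HasCompactSupport g) (m j : ℕ) (ξ : Fin d → ℂ) :
    MvPolynomial.aeval ξ (momentPoly g m j) =
      (m.choose j : ℂ) *
        ∫ x, (-(last x : ℂ)) ^ j * (∑ i, ξ i * (bar x i : ℂ)) ^ (m - j) * (g x : ℂ) := by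
  have hgc' : HasCompactSupport fun x => (g x : ℂ) := hgc.comp_left Complex.ofReal_zero
  have hint : ∀ φ : Fin (m - j) → Fin d, Integrable fun x =>
      (∏ i, ξ (φ i)) * ((-(last x : ℂ)) ^ j * (∏ i, (bar x (φ i) : ℂ)) * (g x : ℂ)) := by
    intro φ
    refine Continuous.integrable_of_hasCompactSupport ?_ hgc'.mul_left.mul_left
    fun_prop
  have hsum : ∀ x, (-(last x : ℂ)) ^ j * (∑ i, ξ i * (bar x i : ℂ)) ^ (m - j) * (g x : ℂ) =
      ∑ φ : Fin (m - j) → Fin d,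
        (∏ i, ξ (φ i)) * ((-(last x : ℂ)) ^ j * (∏ i, (bar x (φ i) : ℂ)) * (g x : ℂ)) := by
    intro x
    rw [Fintype.sum_pow, Finset.mul_sum, Finset.sum_mul]
    refine Finset.sum_congr rfl fun φ _ => ?_
    rw [Finset.prod_mul_distrib]
    ring
  simp only [hsum]
  rw [integral_finsetSum _ fun φ _ => hint φ]
  simp only [momentPoly, map_mul, map_sum, map_prod, MvPolynomial.aeval_X, MvPolynomial.aeval_C,
    integral_const_mul, map_natCast]
  congr 1
  refine Finset.sum_congr rfl fun φ _ => ?_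
  rw [mul_comm]
  congr 1
  rw [Complex.coe_algebraMap, ← integral_complex_ofReal]
  simp

/-- The moments of line integrals of `g` are the integrals of `(x̄ · ξ - x_n (a · ξ))^m g(x)`, which
the binomial theorem expands in powers of `a · ξ`. -/
lemma isMomentCoeff_momentPoly {d : ℕ} {g : E (d + 1) → ℝ} (hg : Continuous g)
    (hgc : HasCompactSupport g) {w : E d → E d → ℝ}
    (hw : ∀ a p, w a p = ∫ s, g (mk (p + s • a) s)) : IsMomentCoeff w (momentPoly g) := by
  refine fun m => ⟨fun j _ => isHomogeneous_momentPoly g m j, fun a ξ => ?_⟩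
  have hgc' : HasCompactSupport fun x => (g x : ℂ) := hgc.comp_left Complex.ofReal_zero
  have hg' : Continuous fun x => (g x : ℂ) := Complex.continuous_ofReal.comp hg
  apply Complex.ofReal_injective
  have h1 : ((moment w m a ξ : ℝ) : ℂ) =
      ∫ x, ((inner ℝ (bar x - last x • a) ξ : ℝ) : ℂ) ^ m * (g x : ℂ) := by
    rw [← integral_mul_integral_line a (φ := fun p => ((inner ℝ p ξ : ℝ) : ℂ) ^ m)
      (by fun_prop) hg' hgc', moment, ← integral_complex_ofReal]
    refine integral_congr_ae (.of_forall fun p => ?_)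
    simp only [hw, Complex.ofReal_mul, Complex.ofReal_pow, ← integral_complex_ofReal]
  have h2 : ∀ x : E (d + 1), ((inner ℝ (bar x - last x • a) ξ : ℝ) : ℂ) ^ m * (g x : ℂ) =
      ∑ j ∈ Finset.range (m + 1), (m.choose j : ℂ) * ((inner ℝ a ξ : ℝ) : ℂ) ^ j *
        ((-(last x : ℂ)) ^ j * (∑ i, (ξ i : ℂ) * (bar x i : ℂ)) ^ (m - j) * (g x : ℂ)) := by
    intro x
    have h3 : ((inner ℝ (bar x - last x • a) ξ : ℝ) : ℂ) =
        -(last x : ℂ) * ((inner ℝ a ξ : ℝ) : ℂ) + ∑ i, (ξ i : ℂ) * (bar x i : ℂ) := by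
      rw [inner_sub_left, inner_smul_left, PiLp.inner_apply (bar x)]
      simp
      ring
    rw [h3, add_pow, Finset.sum_mul]
    refine Finset.sum_congr rfl fun j _ => ?_
    rw [mul_pow]
    ring
  rw [h1]
  simp only [h2]
  rw [integral_finsetSum]
  · simp only [integral_const_mul, Complex.ofReal_sum, Complex.ofReal_mul, Complex.ofReal_pow]
    refine Finset.sum_congr rfl fun j _ => ?_
    have h4 : ((MvPolynomial.eval (fun i => ξ i) (momentPoly g m j) : ℝ) : ℂ) =
        MvPolynomial.aeval (fun i => (ξ i : ℂ)) (momentPoly g m j) :=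
      (MvPolynomial.aeval_algebraMap_apply ℂ (fun i => ξ i) (momentPoly g m j)).symm
    rw [h4, aeval_momentPoly hg hgc]
    ring
  · intro j _
    refine Continuous.integrable_of_hasCompactSupport ?_ hgc'.mul_left.mul_left
    fun_prop

/-- With `A = -i x̄ · ξ` and `B = i x_n`, the terms of the double series are the integrals of
`A^l / l! · B^j / j! · g`; summing over `l` and then over `j` gives `∫ e^{A + B σ} g`. -/
lemma isEntireSum_fourierLaplace {d : ℕ} {g : E (d + 1) → ℝ} (hg : Continuous g)
    (hgc : HasCompactSupport g) :
    IsEntireSum (momentPoly g) (fourierLaplace fun x => (g x : ℂ)) := by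
  have hgc' : HasCompactSupport fun x => (g x : ℂ) := hgc.comp_left Complex.ofReal_zero
  have hg' : Continuous fun x => (g x : ℂ) := Complex.continuous_ofReal.comp hg
  refine ⟨differentiable_fourierLaplace hg' hgc', fun σ ξ => ?_⟩
  set A : E (d + 1) → ℂ := fun x => -Complex.I * ∑ i, ξ i * (bar x i : ℂ) with hA
  set B : E (d + 1) → ℂ := fun x => -Complex.I * -(last x : ℂ) with hB
  have hAc : Continuous A := by fun_prop
  have hBc : Continuous B := by fun_prop
  have hterm : ∀ j l, qTerm (momentPoly g) j ξ l =
      ∫ x, A x ^ l / (l.factorial : ℂ) * (B x ^ j / (j.factorial : ℂ) * (g x : ℂ)) := by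
    intro j l
    have hfac : (((j + l).choose j : ℕ) : ℂ) / ((j + l).factorial : ℂ) =
        1 / (j.factorial * l.factorial : ℂ) := by
      rw [div_eq_div_iff (by exact_mod_cast (j + l).factorial_ne_zero)
        (by exact_mod_cast mul_ne_zero j.factorial_ne_zero l.factorial_ne_zero), one_mul]
      exact_mod_cast (mul_assoc _ _ _).symm.trans
        (by simpa using Nat.choose_mul_factorial_mul_factorial (Nat.le_add_right j l))
    rw [qTerm, aeval_momentPoly hg hgc, Nat.add_sub_cancel_left, ← mul_assoc, div_mul_eq_mul_div,
      mul_div_assoc, hfac, ← integral_const_mul]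
    refine integral_congr_ae (.of_forall fun x => ?_)
    simp only [hA, hB, mul_pow, pow_add]
    ring
  have hsum : ∀ j, HasSum (qTerm (momentPoly g) j ξ)
      (∫ x, Complex.exp (A x) * (B x ^ j / (j.factorial : ℂ) * (g x : ℂ))) := by
    intro j
    rw [show qTerm (momentPoly g) j ξ = _ from funext (hterm j)]
    exact hasSum_integral_exp_series hAc (((hBc.pow j).div_const _).mul hg') hgc'.mul_left
  refine ⟨fun j => (hsum j).summable, ?_⟩
  have hQ : ∀ j, Q (momentPoly g) j ξ * σ ^ j =
      ∫ x, (B x * σ) ^ j / (j.factorial : ℂ) * (Complex.exp (A x) * (g x : ℂ)) := by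
    intro j
    rw [Q, (hsum j).tsum_eq, ← integral_mul_const]
    refine integral_congr_ae (.of_forall fun x => ?_)
    simp only [mul_pow]
    ring
  simp only [hQ]
  have h := hasSum_integral_exp_series (μ := volume) (A := fun x => B x * σ)
    (h := fun x => Complex.exp (A x) * (g x : ℂ)) (by fun_prop) (by fun_prop) hgc'.mul_left
  convert h using 1
  refine integral_congr_ae (.of_forall fun x => ?_)
  simp only
  rw [← mul_assoc, ← Complex.exp_add]
  congr 2
  simp only [pairing, hA, hB]
  ring

/-! ### The Paley–Wiener estimate -/

/-- The support function `max_{t ∈ {-m, -M}} t (Im σ - R |Im ξ̄|)` of the truncated cone. -/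
def supportFn {d : ℕ} (m M R : ℝ) (ζ : ℂ × EuclideanSpace ℂ (Fin d)) : ℝ :=
  max (-m * (ζ.1.im - R * ‖imVec ζ.2‖)) (-M * (ζ.1.im - R * ‖imVec ζ.2‖))

lemma im_pairing_le_supportFn {d : ℕ} {m M R : ℝ} {x : E (d + 1)} (hx : x ∈ truncCone d m M R)
    (ζ : ℂ × EuclideanSpace ℂ (Fin d)) : (pairing x ζ).im ≤ supportFn m M R ζ := by
  obtain ⟨h1, h2, h3⟩ := hx
  rw [im_pairing]
  have h4 : inner ℝ (bar x) (imVec ζ.2) ≤ R * last x * ‖imVec ζ.2‖ :=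
    (real_inner_le_norm _ _).trans (mul_le_mul_of_nonneg_right h3 (norm_nonneg _))
  have h5 : inner ℝ (bar x) (imVec ζ.2) - last x * ζ.1.im ≤
      -last x * (ζ.1.im - R * ‖imVec ζ.2‖) := by linarith
  refine h5.trans ?_
  -- A linear function of `t = -x_n` on `[-M, -m]` is largest at an endpoint.
  rw [supportFn, le_max_iff]
  rcases le_total 0 (ζ.1.im - R * ‖imVec ζ.2‖) with h | h
  · exact .inl (mul_le_mul_of_nonneg_right (neg_le_neg h1) h)
  · exact .inr (mul_le_mul_of_nonpos_right (neg_le_neg h2) h)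

/-- The Paley–Wiener bound without decay. -/
lemma norm_fourierLaplace_le {d : ℕ} {m M R : ℝ} {g : E (d + 1) → ℂ} (hg : Continuous g)
    (hgc : HasCompactSupport g) (hs : Function.support g ⊆ truncCone d m M R)
    (ζ : ℂ × EuclideanSpace ℂ (Fin d)) :
    ‖fourierLaplace g ζ‖ ≤ (∫ x, ‖g x‖) * Real.exp (supportFn m M R ζ) := by
  rw [← integral_mul_const]
  refine norm_integral_le_of_norm_le
    ((hg.norm.integrable_of_hasCompactSupport hgc.norm).mul_const _) (.of_forall fun x => ?_)
  rw [norm_mul, mul_comm, Complex.norm_exp]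
  by_cases hx : g x = 0
  · simp [hx]
  · refine mul_le_mul_of_nonneg_left (Real.exp_le_exp.2 ?_) (norm_nonneg _)
    simpa using im_pairing_le_supportFn (hs hx) ζ

/-- Differentiation in the direction `v` becomes multiplication by `i ⟨v, ζ⟩`. -/
lemma fourierLaplace_fderiv {d : ℕ} {g : E (d + 1) → ℂ} (hg : ContDiff ℝ ∞ g)
    (hgc : HasCompactSupport g) (v : E (d + 1)) (ζ : ℂ × EuclideanSpace ℂ (Fin d)) :
    fourierLaplace (fun x => fderiv ℝ g x v) ζ = Complex.I * pairing v ζ * fourierLaplace g ζ := by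
  set e : E (d + 1) → ℂ := fun x => Complex.exp (-Complex.I * pairing x ζ)
  have he : ∀ x, HasFDerivAt e (e x • (-Complex.I) • pairingR ζ) x := by
    intro x
    have h1 : HasFDerivAt (fun x => -Complex.I * pairing x ζ) ((-Complex.I) • pairingR ζ) x :=
      (pairingR ζ).hasFDerivAt.const_mul (-Complex.I)
    exact h1.cexp
  have hed : ∀ x, fderiv ℝ e x v = -Complex.I * pairing v ζ * e x := by
    intro x
    rw [(he x).fderiv]
    simp [pairingR_apply]
    ring
  have hec : Continuous e :=
    Complex.continuous_exp.comp (continuous_const.mul (continuous_pairing_left ζ))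
  have hg' : Continuous fun x => fderiv ℝ g x v :=
    (hg.continuous_fderiv (by simp)).clm_apply continuous_const
  have hgc' : HasCompactSupport fun x => fderiv ℝ g x v := hgc.fderiv_apply ℝ v
  have hparts := integral_mul_fderiv_eq_neg_fderiv_mul_of_integrable (μ := volume)
    (f := e) (g := g) (v := v)
    (by
      simp only [hed]
      exact ((continuous_const.mul hec).mul hg.continuous).integrable_of_hasCompactSupport
        hgc.mul_left)
    ((hec.mul hg').integrable_of_hasCompactSupport hgc'.mul_left)
    ((hec.mul hg.continuous).integrable_of_hasCompactSupport hgc.mul_left)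
    (fun x _ => (he x).differentiableAt) (fun x _ => (hg.differentiable (by simp)).differentiableAt)
  change ∫ x, e x * fderiv ℝ g x v = Complex.I * pairing v ζ * ∫ x, e x * g x
  rw [hparts, ← integral_const_mul, ← integral_neg]
  refine integral_congr_ae (.of_forall fun x => ?_)
  simp only [hed]
  ring

/-- The size `1 + |σ| + ∑ |ξ_i|` of a complex frequency; each summand is the modulus of the
symbol of a differential operator of order at most one. -/
def freqSize {d : ℕ} (ζ : ℂ × EuclideanSpace ℂ (Fin d)) : ℝ := 1 + ‖ζ.1‖ + ∑ i, ‖ζ.2 i‖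

lemma le_freqSize {d : ℕ} (ζ : ℂ × EuclideanSpace ℂ (Fin d)) :
    1 + ‖ζ.1‖ + ‖ζ.2‖ ≤ freqSize ζ := by
  refine add_le_add_right ?_ _
  refine le_of_sq_le_sq ?_ (Finset.sum_nonneg fun i _ => norm_nonneg _)
  rw [EuclideanSpace.norm_sq_eq]
  exact Finset.sum_sq_le_sq_sum_of_nonneg fun i _ => norm_nonneg _

/-- Each further factor `freqSize` costs one derivative of `g`, which stays supported in the cone;
hence the induction on `N` runs over all smooth `g`. -/
lemma exists_freqSize_pow_mul_le {d : ℕ} {m M R : ℝ} (hR : 0 ≤ R) (N : ℕ) :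
    ∀ g : E (d + 1) → ℂ, ContDiff ℝ ∞ g → Function.support g ⊆ truncCone d m M R →
      ∃ C, ∀ ζ, freqSize ζ ^ N * ‖fourierLaplace g ζ‖ ≤ C * Real.exp (supportFn m M R ζ) := by
  have hK := isCompact_truncCone d (m := m) (M := M) hR
  induction N with
  | zero =>
    intro g hg hs
    refine ⟨∫ x, ‖g x‖, fun ζ => ?_⟩
    simpa using norm_fourierLaplace_le hg.continuous
      (HasCompactSupport.of_support_subset_isCompact hK hs) hs ζ
  | succ N ih =>
    intro g hg hs
    have hgc : HasCompactSupport g := HasCompactSupport.of_support_subset_isCompact hK hs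
    have hderiv : ∀ v, ∃ C, ∀ ζ, freqSize ζ ^ N * (‖pairing v ζ‖ * ‖fourierLaplace g ζ‖) ≤
        C * Real.exp (supportFn m M R ζ) := by
      intro v
      obtain ⟨C, hC⟩ := ih (fun x => fderiv ℝ g x v)
        ((hg.fderiv_right (m := ∞) (by simp)).clm_apply contDiff_const)
        ((subset_tsupport _).trans ((tsupport_fderiv_apply_subset ℝ v).trans
          (closure_minimal hs hK.isClosed)))
      refine ⟨C, fun ζ => ?_⟩
      have := hC ζ
      rwa [fourierLaplace_fderiv hg hgc, norm_mul, norm_mul, Complex.norm_I, one_mul] at this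
    obtain ⟨C₀, h₀⟩ := ih g hg hs
    obtain ⟨C₁, h₁⟩ := hderiv (mk 0 1)
    choose C hC using fun i => hderiv (mk (EuclideanSpace.single i 1) 0)
    refine ⟨C₀ + C₁ + ∑ i, C i, fun ζ => ?_⟩
    have e₁ : ‖pairing (mk 0 1) ζ‖ = ‖ζ.1‖ := by simp [pairing]
    have e₂ : ∀ i, ‖pairing (mk (EuclideanSpace.single i 1) 0) ζ‖ = ‖ζ.2 i‖ := by
      intro i
      simp [pairing, apply_ite Complex.ofReal]
    calc freqSize ζ ^ (N + 1) * ‖fourierLaplace g ζ‖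
        = freqSize ζ ^ N * ‖fourierLaplace g ζ‖ +
            freqSize ζ ^ N * (‖ζ.1‖ * ‖fourierLaplace g ζ‖) +
            ∑ i, freqSize ζ ^ N * (‖ζ.2 i‖ * ‖fourierLaplace g ζ‖) := by
          rw [← Finset.mul_sum, ← Finset.sum_mul, pow_succ, freqSize]
          ring
      _ ≤ C₀ * Real.exp (supportFn m M R ζ) + C₁ * Real.exp (supportFn m M R ζ) +
            ∑ i, C i * Real.exp (supportFn m M R ζ) := by
          refine add_le_add (add_le_add (h₀ ζ) ?_) (Finset.sum_le_sum fun i _ => ?_)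
          · simpa only [e₁] using h₁ ζ
          · simpa only [e₂] using hC i ζ
      _ = _ := by rw [← Finset.sum_mul]; ring

lemma paleyWienerBound_fourierLaplace {d : ℕ} {m M R : ℝ} (hR : 0 ≤ R) {g : E (d + 1) → ℂ}
    (hg : ContDiff ℝ ∞ g) (hs : Function.support g ⊆ truncCone d m M R) :
    PaleyWienerBound m M R (fourierLaplace g) := by
  intro N
  obtain ⟨C, hC⟩ := exists_freqSize_pow_mul_le hR N g hg hs
  refine ⟨|C| + 1, by positivity, fun σ ξ => ?_⟩
  have h1 : 0 < 1 + ‖σ‖ + ‖ξ‖ := by positivity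
  have h2 := hC (σ, ξ)
  have h3 : (1 + ‖σ‖ + ‖ξ‖) ^ N * ‖fourierLaplace g (σ, ξ)‖ ≤
      (|C| + 1) * Real.exp (supportFn m M R (σ, ξ)) := by
    refine (mul_le_mul_of_nonneg_right (pow_le_pow_left₀ h1.le (le_freqSize (σ, ξ)) N)
      (norm_nonneg _)).trans (h2.trans ?_)
    exact mul_le_mul_of_nonneg_right ((le_abs_self C).trans (by simp)) (Real.exp_pos _).le
  rw [zpow_neg, zpow_natCast, mul_right_comm, ← div_eq_mul_inv, le_div_iff₀ (pow_pos h1 N),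
    mul_comm]
  exact h3

/-- Line integrals of a compactly supported function in a fixed direction are supported in the
shadow of its support. -/
lemma hasCompactSupport_integral_line {d : ℕ} {F : Type*} [NormedAddCommGroup F]
    [NormedSpace ℝ F] (a : E d) {g : E (d + 1) → F} (hgc : HasCompactSupport g) :
    HasCompactSupport fun p => ∫ s, g (mk (p + s • a) s) := by
  refine HasCompactSupport.intro
    (K := (fun x => bar x - last x • a) '' tsupport g)
    (IsCompact.image hgc (by fun_prop)) fun p hp => ?_
  refine integral_eq_zero_of_ae (.of_forall fun s => ?_)
  refine image_eq_zero_of_notMem_tsupport fun h => hp ⟨_, h, ?_⟩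
  simp

/-! ### Rearranging the defining series of the entire function -/

/-- Cauchy's estimate for the coefficients of an everywhere convergent power series. -/
lemma norm_coeff_mul_pow_le {a : ℕ → ℂ} {f : ℂ → ℂ} (hf : ∀ z, HasSum (fun n => a n * z ^ n) (f z))
    {r C : ℝ} (hr : 0 < r) (hC : ∀ z : ℂ, ‖z‖ = r → ‖f z‖ ≤ C) (n : ℕ) : ‖a n‖ * r ^ n ≤ C := by
  have hd : Differentiable ℂ f := by
    intro z
    have hu : Summable fun n => ‖a n * ((‖z‖ + 1 : ℝ) : ℂ) ^ n‖ := (hf _).summable.norm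
    have h := Complex.differentiableOn_tsum_of_summable_norm hu
      (F := fun n w => a n * w ^ n) (U := Metric.ball 0 (‖z‖ + 1))
      (fun n => by fun_prop) Metric.isOpen_ball (fun n w hw => by
        rw [mem_ball_zero_iff] at hw
        rw [norm_mul, norm_mul, norm_pow, norm_pow, Complex.norm_real,
          Real.norm_of_nonneg (by positivity)]
        gcongr)
    rw [show (fun w => ∑' n, a n * w ^ n) = f from funext fun w => (hf w).tsum_eq] at h
    exact h.differentiableAt (Metric.isOpen_ball.mem_nhds (by simp))
  have hps : HasFPowerSeriesAt f (FormalMultilinearSeries.ofScalars ℂ a) 0 := by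
    rw [hasFPowerSeriesAt_iff]
    refine .of_forall fun z => ?_
    simpa [FormalMultilinearSeries.coeff_ofScalars, mul_comm] using hf z
  obtain ⟨ρ, hρ⟩ := hps
  have h1 := hρ.factorial_smul (1 : ℂ) n
  rw [← iteratedDeriv_eq_iteratedFDeriv] at h1
  have h2 := Complex.norm_iteratedDeriv_le_of_forall_mem_sphere_norm_le (c := 0) n hr
    hd.diffContOnCl (fun z hz => hC z (by simpa using hz))
  rw [← h1] at h2
  have h3 : (0 : ℝ) < n.factorial := by exact_mod_cast n.factorial_pos
  have h4 : (n.factorial : ℝ) * ‖a n‖ ≤ n.factorial * C / r ^ n := by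
    simpa [FormalMultilinearSeries.ofScalars_apply_eq] using h2
  rw [mul_div_assoc, mul_le_mul_iff_of_pos_left h3, le_div_iff₀ (pow_pos hr n)] at h4
  exact h4

/-- An entire function of two variables given by an iterated power series is the sum of the
corresponding absolutely convergent double series. -/
lemma hasSum_prod_of_entire {h : ℂ × ℂ → ℂ} (hh : Continuous h) {q : ℕ → ℂ → ℂ}
    {b : ℕ → ℕ → ℂ} (hq : ∀ σ t, HasSum (fun j => q j t * σ ^ j) (h (σ, t)))
    (hb : ∀ j t, HasSum (fun l => b j l * t ^ l) (q j t)) (σ : ℂ) :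
    HasSum (fun z : ℕ × ℕ => b z.1 z.2 * σ ^ z.1) (h (σ, 1)) := by
  -- Radii `r ≥ 2 |σ|` and `2 = 2 · 1` leave a factor `1/2` per power of each variable.
  set r : ℝ := 2 * ‖σ‖ + 1
  have hr : 0 < r := by positivity
  obtain ⟨M, hM⟩ := ((isCompact_closedBall (0 : ℂ) r).prod
    (isCompact_closedBall (0 : ℂ) 2)).exists_bound_of_continuousOn hh.continuousOn
  have hM0 : 0 ≤ M := (norm_nonneg _).trans (hM (0, 0) ⟨by simpa using hr.le, by simp⟩)
  have h1 : ∀ j (t : ℂ), ‖t‖ = 2 → ‖q j t‖ ≤ M / r ^ j := by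
    intro j t ht
    rw [le_div_iff₀ (pow_pos hr j)]
    exact norm_coeff_mul_pow_le (fun σ => hq σ t) hr
      (fun z hz => hM (z, t) ⟨by simpa using hz.le, by simpa using ht.le⟩) j
  have h2 : ∀ j l, ‖b j l‖ * 2 ^ l ≤ M / r ^ j := fun j l =>
    norm_coeff_mul_pow_le (hb j) two_pos (h1 j) l
  have hbound : ∀ z : ℕ × ℕ, ‖b z.1 z.2 * σ ^ z.1‖ ≤
      M * ((1 / 2 : ℝ) ^ z.1 * (1 / 2 : ℝ) ^ z.2) := by
    rintro ⟨j, l⟩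
    have h3 : ‖σ‖ ^ j ≤ (1 / 2 : ℝ) ^ j * r ^ j := by
      rw [← mul_pow]
      exact pow_le_pow_left₀ (norm_nonneg _) (by simp only [r]; linarith) j
    have h4 : ‖b j l‖ ≤ M / r ^ j * (1 / 2 : ℝ) ^ l := by
      rw [one_div_pow, mul_one_div, le_div_iff₀ (by positivity)]
      exact h2 j l
    rw [norm_mul, norm_pow]
    calc ‖b j l‖ * ‖σ‖ ^ j ≤ (M / r ^ j * (1 / 2 : ℝ) ^ l) * ((1 / 2 : ℝ) ^ j * r ^ j) := by
          gcongr
      _ = M * ((1 / 2 : ℝ) ^ j * (1 / 2 : ℝ) ^ l) := by field_simp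
  have hgeo : Summable fun n : ℕ => (1 / 2 : ℝ) ^ n := summable_geometric_two
  have hsum : Summable fun z : ℕ × ℕ => b z.1 z.2 * σ ^ z.1 :=
    .of_norm_bounded ((hgeo.mul_of_nonneg hgeo (fun _ => by positivity)
      (fun _ => by positivity)).mul_left M) hbound
  have h5 := hsum.hasSum.prod_fiberwise fun j => by
    simpa using (hb j 1).mul_right (σ ^ j)
  rw [← h5.unique (hq σ 1)]
  exact hsum.hasSum

lemma aeval_smul_of_isHomogeneous {ι : Type*} [Fintype ι] {p : MvPolynomial ι ℝ} {n : ℕ}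
    (hp : p.IsHomogeneous n) (t : ℂ) (ξ : ι → ℂ) :
    MvPolynomial.aeval (fun i => t * ξ i) p = t ^ n * MvPolynomial.aeval ξ p := by
  rw [MvPolynomial.aeval_def, MvPolynomial.aeval_def, MvPolynomial.eval₂_eq',
    MvPolynomial.eval₂_eq', Finset.mul_sum]
  refine Finset.sum_congr rfl fun e he => ?_
  have h1 : ∑ i, e i = n := by
    have := hp (MvPolynomial.mem_support_iff.1 he)
    change Finsupp.weight (fun _ => 1) e = n at this
    rwa [← Finsupp.degree_eq_weight_one, Finsupp.degree_eq_sum] at this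
  simp only [mul_pow, Finset.prod_mul_distrib, Finset.prod_pow_eq_pow_sum, h1]
  ring

/-- A real vector as a complex one. -/
def toC {d : ℕ} (ξ : E d) : EuclideanSpace ℂ (Fin d) := WithLp.toLp 2 fun i => (ξ i : ℂ)

/-- The Fourier transform of the data in the projective variable is the restriction of the entire
function to `σ = ā · ξ̄`. -/
lemma integral_exp_mul_eq_of_isEntireSum {d : ℕ} {w : E d → E d → ℝ}
    {c : ℕ → ℕ → MvPolynomial (Fin d) ℝ} {H : ℂ × EuclideanSpace ℂ (Fin d) → ℂ}
    (hc : IsMomentCoeff w c) (hH : IsEntireSum c H) (a : E d) (hw : Continuous (w a))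
    (hwc : HasCompactSupport (w a)) (ξ : E d) :
    ∫ p, Complex.exp (-Complex.I * ((inner ℝ p ξ : ℝ) : ℂ)) * (w a p : ℂ) =
      H (((inner ℝ a ξ : ℝ) : ℂ), toC ξ) := by
  set σ : ℂ := ((inner ℝ a ξ : ℝ) : ℂ)
  have hhom : ∀ j l, (c (j + l) j).IsHomogeneous l := fun j l => by
    simpa using (hc (j + l)).1 j (Nat.le_add_right j l)
  have hdouble : HasSum (fun z : ℕ × ℕ => qTerm c z.1 (toC ξ) z.2 * σ ^ z.1) (H (σ, toC ξ)) := by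
    -- Scaling `ξ` by `t` turns the homogeneous terms of `Q_j` into a power series in `t`.
    have hcont : Continuous fun z : ℂ × ℂ => H (z.1, z.2 • toC ξ) :=
      hH.1.continuous.comp (by fun_prop)
    have h := hasSum_prod_of_entire hcont (q := fun j t => Q c j (t • toC ξ))
      (b := fun j => qTerm c j (toC ξ)) (fun σ t => (hH.2 σ (t • toC ξ)).2) (fun j t => ?_) σ
    · simpa using h
    · have h1 : ∀ l, qTerm c j (toC ξ) l * t ^ l = qTerm c j (t • toC ξ) l := by
        intro l
        simp only [qTerm, PiLp.smul_apply, smul_eq_mul, aeval_smul_of_isHomogeneous (hhom j l)]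
        ring
      simp only [h1]
      exact ((hH.2 0 (t • toC ξ)).1 j).hasSum
  have hwC : Continuous fun p => (w a p : ℂ) := Complex.continuous_ofReal.comp hw
  have hwcC : HasCompactSupport fun p => (w a p : ℂ) := hwc.comp_left Complex.ofReal_zero
  have hexp := hasSum_integral_exp_series (μ := (volume : Measure (E d)))
    (A := fun p => -Complex.I * ((inner ℝ p ξ : ℝ) : ℂ)) (by fun_prop) hwC hwcC
  refine hexp.unique ?_
  -- Rearrange the double series by total degree `m = j + l`.
  have hanti := ((Finset.HasAntidiagonal.sigmaAntidiagonalEquivProd (A := ℕ)).hasSum_iff.2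
    hdouble).sigma fun m =>
    (Finset.HasAntidiagonal.antidiagonal m).hasSum
      fun z : ℕ × ℕ => qTerm c z.1 (toC ξ) z.2 * σ ^ z.1
  convert hanti using 1
  funext m
  have hmom : ∫ p, (-Complex.I * ((inner ℝ p ξ : ℝ) : ℂ)) ^ m / (m.factorial : ℂ) * (w a p : ℂ) =
      (-Complex.I) ^ m / (m.factorial : ℂ) * ((moment w m a ξ : ℝ) : ℂ) := by
    rw [moment, ← integral_complex_ofReal, ← integral_const_mul]
    refine integral_congr_ae (.of_forall fun p => ?_)
    simp only [mul_pow, Complex.ofReal_mul, Complex.ofReal_pow]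
    ring
  rw [hmom, (hc m).2]
  rw [Finset.Nat.sum_antidiagonal_eq_sum_range_succ_mk, Complex.ofReal_sum, Finset.mul_sum]
  refine Finset.sum_congr rfl fun j hj => ?_
  have hjm : j + (m - j) = m := Nat.add_sub_cancel' (Finset.mem_range_succ_iff.1 hj)
  have h4 : ((MvPolynomial.eval (fun i => ξ i) (c m j) : ℝ) : ℂ) =
      MvPolynomial.aeval (fun i => toC ξ i) (c m j) :=
    (MvPolynomial.aeval_algebraMap_apply ℂ (fun i => ξ i) (c m j)).symm
  simp only [qTerm, hjm, Complex.ofReal_mul, Complex.ofReal_pow, h4]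
  ring

open Filter

/-! ### Contour shifts and the support of the inverse transform -/

lemma norm_toC {d : ℕ} (ξ : E d) : ‖toC ξ‖ = ‖ξ‖ := by
  simp [EuclideanSpace.norm_eq, toC]

/-- The complex frequency `(-y_n, ȳ)` of a real covector `y`, so that the pairing with it is the
inner product of `ℝ^n`. -/
def realFreq (d : ℕ) : E (d + 1) →L[ℝ] ℂ × EuclideanSpace ℂ (Fin d) :=
  LinearMap.toContinuousLinearMap
    { toFun := fun y => (-(last y : ℂ), toC (bar y))
      map_add' := fun x y => by
        refine Prod.ext ?_ ?_
        · simp [last_add]; ring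
        · ext i; simp [toC, bar_add]
      map_smul' := fun r x => by
        refine Prod.ext ?_ ?_
        · simp [last_smul]
        · ext i; simp [toC, bar_smul] }

lemma realFreq_apply {d : ℕ} (y : E (d + 1)) :
    realFreq d y = (-(last y : ℂ), toC (bar y)) := rfl

lemma pairing_add {d : ℕ} (x : E (d + 1)) (ζ ζ' : ℂ × EuclideanSpace ℂ (Fin d)) :
    pairing x (ζ + ζ') = pairing x ζ + pairing x ζ' := by
  simp only [← pairingL_apply, map_add]

lemma pairing_smul {d : ℕ} (x : E (d + 1)) (t : ℂ) (ζ : ℂ × EuclideanSpace ℂ (Fin d)) :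
    pairing x (t • ζ) = t * pairing x ζ := by
  simp only [← pairingL_apply, map_smul, smul_eq_mul]

lemma pairing_realFreq {d : ℕ} (x y : E (d + 1)) :
    pairing x (realFreq d y) = ((inner ℝ x y : ℝ) : ℂ) := by
  rw [inner_eq_bar_last]
  simp [pairing, realFreq_apply, toC, PiLp.inner_apply, mul_comm]

/-- The frequency `y + τ η`, for real covectors `y`, `η` and a complex parameter `τ`. -/
def shiftFreq {d : ℕ} (η y : E (d + 1)) (τ : ℂ) : ℂ × EuclideanSpace ℂ (Fin d) :=
  realFreq d y + τ • realFreq d η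

lemma shiftFreq_add_ofReal {d : ℕ} (η y : E (d + 1)) (τ : ℂ) (r : ℝ) :
    shiftFreq η y (τ + r) = shiftFreq η (y + r • η) τ := by
  have : ((r : ℂ) • realFreq d η) = realFreq d (r • η) := by
    rw [map_smul]
    exact Complex.coe_smul r _
  rw [shiftFreq, shiftFreq, add_smul, this, map_add]
  abel

lemma im_shiftFreq_fst {d : ℕ} (η y : E (d + 1)) (τ : ℂ) :
    (shiftFreq η y τ).1.im = -(τ.im * last η) := by
  simp [shiftFreq, realFreq_apply]

lemma imVec_shiftFreq {d : ℕ} (η y : E (d + 1)) (τ : ℂ) :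
    imVec (shiftFreq η y τ).2 = τ.im • bar η := by
  ext i
  simp [shiftFreq, realFreq_apply, imVec, toC]

/-- A bounded shift changes the size of the frequency by a bounded factor only. -/
lemma one_add_norm_le_shiftFreq {d : ℕ} (η y : E (d + 1)) (τ : ℂ) :
    1 + ‖y‖ ≤ (1 + ‖(shiftFreq η y τ).1‖ + ‖(shiftFreq η y τ).2‖) *
      (1 + ‖τ‖ * (|last η| + ‖bar η‖)) := by
  have h1 : ‖y‖ ≤ ‖bar y‖ + |last y| := by
    simpa using norm_mk_le (bar y) (last y)
  have h2 : |last y| ≤ ‖(shiftFreq η y τ).1‖ + ‖τ‖ * |last η| := by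
    have : (-(last y : ℂ)) = (shiftFreq η y τ).1 - τ * (-(last η : ℂ)) := by
      simp [shiftFreq, realFreq_apply]
    calc |last y| = ‖(-(last y : ℂ))‖ := by simp
      _ ≤ _ := by rw [this]; exact (norm_sub_le _ _).trans (by simp)
  have h3 : ‖bar y‖ ≤ ‖(shiftFreq η y τ).2‖ + ‖τ‖ * ‖bar η‖ := by
    have : toC (bar y) = (shiftFreq η y τ).2 - τ • toC (bar η) := by
      simp [shiftFreq, realFreq_apply]
    rw [← norm_toC (bar y), this]
    exact (norm_sub_le _ _).trans (by rw [norm_smul, norm_toC])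
  have h4 : 0 ≤ ‖(shiftFreq η y τ).1‖ := norm_nonneg _
  have h5 : 0 ≤ ‖(shiftFreq η y τ).2‖ := norm_nonneg _
  have h6 : 0 ≤ ‖τ‖ * (|last η| + ‖bar η‖) := by positivity
  nlinarith [mul_nonneg h4 h6, mul_nonneg h5 h6]

/-- The inversion integrand at the shifted frequency. -/
def shiftKernel {d : ℕ} (H : ℂ × EuclideanSpace ℂ (Fin d) → ℂ) (x η y : E (d + 1)) (τ : ℂ) : ℂ :=
  Complex.exp (Complex.I * pairing x (shiftFreq η y τ)) * H (shiftFreq η y τ)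

/-- The part of the bound on `shiftKernel` that depends on the complex shift only. -/
def shiftBound {d : ℕ} (m M R : ℝ) (N : ℕ) (x η : E (d + 1)) (τ : ℂ) : ℝ :=
  (1 + ‖τ‖ * (|last η| + ‖bar η‖)) ^ N *
    Real.exp (max (-m * (-(τ.im * last η) - R * ‖τ.im • bar η‖))
      (-M * (-(τ.im * last η) - R * ‖τ.im • bar η‖)) - τ.im * inner ℝ x η)

lemma continuous_shiftBound {d : ℕ} (m M R : ℝ) (N : ℕ) (x η : E (d + 1)) :
    Continuous (shiftBound m M R N x η) := by
  unfold shiftBound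
  fun_prop

/-- At shift `τ` the Paley–Wiener bound decays in the real frequency `y`, locally uniformly
in `τ`. -/
lemma norm_shiftKernel_le {d : ℕ} {m M R : ℝ} {H : ℂ × EuclideanSpace ℂ (Fin d) → ℂ}
    (hH : PaleyWienerBound m M R H) (N : ℕ) : ∃ C, 0 < C ∧ ∀ (x η y : E (d + 1)) (τ : ℂ),
      ‖shiftKernel H x η y τ‖ ≤ C * shiftBound m M R N x η τ * ((1 + ‖y‖) ^ N)⁻¹ := by
  obtain ⟨C, hC, h⟩ := hH N
  refine ⟨C, hC, fun x η y τ => ?_⟩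
  have h1 := h (shiftFreq η y τ).1 (shiftFreq η y τ).2
  rw [im_shiftFreq_fst, imVec_shiftFreq, zpow_neg, zpow_natCast, Prod.mk.eta] at h1
  have h2 : ‖Complex.exp (Complex.I * pairing x (shiftFreq η y τ))‖ =
      Real.exp (-(τ.im * inner ℝ x η)) := by
    rw [Complex.norm_exp, shiftFreq, pairing_add, pairing_smul, pairing_realFreq, pairing_realFreq]
    simp
  have h3 := one_add_norm_le_shiftFreq η y τ
  set S := 1 + ‖(shiftFreq η y τ).1‖ + ‖(shiftFreq η y τ).2‖
  set T := 1 + ‖τ‖ * (|last η| + ‖bar η‖)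
  have hS : 0 < S := by positivity
  have hT : 0 < T := by positivity
  have h4 : (S ^ N)⁻¹ ≤ T ^ N * ((1 + ‖y‖) ^ N)⁻¹ := by
    rw [← div_eq_mul_inv, le_div_iff₀ (by positivity), inv_mul_le_iff₀ (by positivity), ← mul_pow]
    exact pow_le_pow_left₀ (by positivity) h3 N
  rw [shiftKernel, norm_mul, h2, shiftBound, sub_eq_add_neg, Real.exp_add]
  refine (mul_le_mul_of_nonneg_left h1 (Real.exp_pos _).le).trans ?_
  calc _ ≤ Real.exp (-(τ.im * inner ℝ x η)) * (C * (T ^ N * ((1 + ‖y‖) ^ N)⁻¹) *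
        Real.exp (max (-m * (-(τ.im * last η) - R * ‖τ.im • bar η‖))
          (-M * (-(τ.im * last η) - R * ‖τ.im • bar η‖)))) := by gcongr
    _ = _ := by ring

lemma integrable_inv_one_add_norm_pow (n : ℕ) :
    Integrable fun y : E n => ((1 + ‖y‖) ^ (n + 1))⁻¹ := by
  have h := integrable_one_add_norm (E := E n) (μ := volume) (r := (n : ℝ) + 1) (by simp)
  refine h.congr (.of_forall fun y => ?_)
  have : (0 : ℝ) < 1 + ‖y‖ := by positivity
  simp only
  rw [Real.rpow_neg this.le, ← Nat.cast_succ, Real.rpow_natCast]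

lemma continuous_shiftKernel {d : ℕ} {H : ℂ × EuclideanSpace ℂ (Fin d) → ℂ} (hH : Continuous H)
    (x η : E (d + 1)) : Continuous fun z : E (d + 1) × ℂ => shiftKernel H x η z.1 z.2 := by
  have h : Continuous fun z : E (d + 1) × ℂ => shiftFreq η z.1 z.2 := by
    unfold shiftFreq
    fun_prop
  exact (Complex.continuous_exp.comp (continuous_const.mul
    (continuous_pairing.comp (continuous_const.prodMk h)))).mul (hH.comp h)

lemma differentiable_shiftKernel {d : ℕ} {H : ℂ × EuclideanSpace ℂ (Fin d) → ℂ}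
    (hH : Differentiable ℂ H) (x η y : E (d + 1)) : Differentiable ℂ (shiftKernel H x η y) := by
  have h : Differentiable ℂ fun τ : ℂ => shiftFreq η y τ := by
    unfold shiftFreq
    fun_prop
  have h1 : Differentiable ℂ fun τ : ℂ => pairing x (shiftFreq η y τ) := by
    simpa only [Function.comp_def, pairingL_apply] using (pairingL x).differentiable.comp h
  exact (h1.const_mul Complex.I).cexp.mul (hH.comp h)

/-- The shifted inversion integral is entire in the shift. -/
lemma differentiable_integral_shiftKernel {d : ℕ} {m M R : ℝ}
    {H : ℂ × EuclideanSpace ℂ (Fin d) → ℂ} (hd : Differentiable ℂ H)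
    (hH : PaleyWienerBound m M R H) (x η : E (d + 1)) :
    Differentiable ℂ fun τ => ∫ y, shiftKernel H x η y τ := by
  intro τ₀
  obtain ⟨C, hC, hbd⟩ := norm_shiftKernel_le hH (d + 1 + 1)
  -- A bound on the ball of radius `2` gives, by Cauchy's estimate on unit circles, a bound on the
  -- derivative in the ball of radius `1`.
  obtain ⟨B, hB⟩ := (isCompact_closedBall τ₀ 2).exists_bound_of_continuousOn
    (continuous_shiftBound m M R (d + 1 + 1) x η).continuousOn
  have hint := integrable_inv_one_add_norm_pow (d + 1)
  have hcont := continuous_shiftKernel hd.continuous x η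
  have hmeas : ∀ τ, AEStronglyMeasurable (fun y => shiftKernel H x η y τ) volume := fun τ =>
    (hcont.comp (continuous_id.prodMk continuous_const)).aestronglyMeasurable
  have hle : ∀ y, ∀ τ ∈ Metric.closedBall τ₀ 2,
      ‖shiftKernel H x η y τ‖ ≤ C * B * ((1 + ‖y‖) ^ (d + 1 + 1))⁻¹ := by
    intro y τ hτ
    refine (hbd x η y τ).trans ?_
    have := (le_abs_self _).trans (hB τ hτ)
    gcongr
  refine (hasDerivAt_integral_of_dominated_loc_of_deriv_le
    (F := fun τ y => shiftKernel H x η y τ) (F' := fun τ y => deriv (shiftKernel H x η y) τ)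
    (bound := fun y => C * B * ((1 + ‖y‖) ^ (d + 1 + 1))⁻¹)
    (Metric.ball_mem_nhds τ₀ one_pos) (.of_forall hmeas) ?_ ?_ ?_ (hint.const_mul _)
    ?_).2.differentiableAt
  · exact (hint.const_mul _).mono' (hmeas τ₀) (.of_forall fun y => hle y τ₀ (by simp))
  · exact ((stronglyMeasurable_deriv_with_param (f := shiftKernel H x η) hcont).comp_measurable
      (measurable_id.prodMk measurable_const)).aestronglyMeasurable
  · refine .of_forall fun y τ hτ => ?_
    have h := Complex.norm_deriv_le_of_forall_mem_sphere_norm_le (c := τ) one_pos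
      (differentiable_shiftKernel hd x η y).diffContOnCl fun z hz => hle y z ?_
    · simpa using h
    · rw [Metric.mem_closedBall]
      rw [Metric.mem_sphere] at hz
      rw [Metric.mem_ball] at hτ
      linarith [dist_triangle z τ τ₀]
  · exact .of_forall fun y τ _ => (differentiable_shiftKernel hd x η y τ).hasDerivAt

/-- The shifted inversion integral does not depend on the shift: it is entire in `τ` and, by
translation invariance of Lebesgue measure, invariant under real translations of `τ`. -/
lemma integral_shiftKernel_eq {d : ℕ} {m M R : ℝ} {H : ℂ × EuclideanSpace ℂ (Fin d) → ℂ}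
    (hd : Differentiable ℂ H) (hH : PaleyWienerBound m M R H) (x η : E (d + 1)) (τ τ' : ℂ) :
    ∫ y, shiftKernel H x η y τ = ∫ y, shiftKernel H x η y τ' := by
  have hdiff := differentiable_integral_shiftKernel hd hH x η
  refine is_const_of_deriv_eq_zero hdiff (fun τ => ?_) τ τ'
  have hinv : ∀ r : ℝ, ∫ y, shiftKernel H x η y (τ + r) = ∫ y, shiftKernel H x η y τ := by
    intro r
    simp only [shiftKernel, shiftFreq_add_ofReal]
    exact integral_add_right_eq_self (fun y => shiftKernel H x η y τ) (r • η)
  have h1 : HasDerivAt (fun z : ℂ => ∫ y, shiftKernel H x η y (τ + z))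
      (deriv (fun τ => ∫ y, shiftKernel H x η y τ) τ) ((0 : ℝ) : ℂ) := by
    have h2 : HasDerivAt (fun τ => ∫ y, shiftKernel H x η y τ)
        (deriv (fun τ => ∫ y, shiftKernel H x η y τ) τ) (τ + ((0 : ℝ) : ℂ)) := by
      rw [Complex.ofReal_zero, add_zero]
      exact (hdiff τ).hasDerivAt
    exact h2.comp_const_add τ _
  have h3 := h1.comp_ofReal
  simp only [hinv] at h3
  exact h3.unique (hasDerivAt_const _ _)

lemma tendsto_pow_mul_exp_neg (L δ : ℝ) (hδ : 0 < δ) (N : ℕ) :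
    Tendsto (fun T : ℝ => (1 + T * L) ^ N * Real.exp (-(T * δ))) atTop (nhds 0) := by
  have h := (isLittleO_pow_exp_pos_mul_atTop N hδ)
  have hO : (fun T : ℝ => 1 + T * L) =O[atTop] fun T : ℝ => T := by
    refine Asymptotics.IsBigO.add ?_ ?_
    · exact (Asymptotics.isLittleO_const_id_atTop (1 : ℝ)).isBigO
    · simpa only [mul_comm L] using Asymptotics.isBigO_const_mul_self L (fun T : ℝ => T) atTop
  have h2 := ((hO.pow N).trans_isLittleO h).tendsto_div_nhds_zero
  refine h2.congr fun T => ?_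
  rw [Real.exp_neg, mul_comm T δ, div_eq_mul_inv]

/-- Shifting the contour to infinity in a direction `η` separating `x` from the truncated cone
shows that the inversion integral vanishes at `x`. -/
lemma integral_shiftKernel_eq_zero_of_separated {d : ℕ} {m M R : ℝ}
    {H : ℂ × EuclideanSpace ℂ (Fin d) → ℂ} (hd : Differentiable ℂ H)
    (hH : PaleyWienerBound m M R H) (x η : E (d + 1))
    (hsep : max (m * (last η + R * ‖bar η‖)) (M * (last η + R * ‖bar η‖)) < inner ℝ x η) :
    ∫ y, shiftKernel H x η y 0 = 0 := by
  set δ := inner ℝ x η - max (m * (last η + R * ‖bar η‖)) (M * (last η + R * ‖bar η‖)) with hδ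
  have hδ0 : 0 < δ := sub_pos.2 hsep
  set L := |last η| + ‖bar η‖ with hL
  obtain ⟨C, hC, hbd⟩ := norm_shiftKernel_le hH (d + 1 + 1)
  have hint := integrable_inv_one_add_norm_pow (d + 1)
  set A := ∫ y : E (d + 1), ((1 + ‖y‖) ^ (d + 1 + 1))⁻¹
  have hle : ∀ T : ℝ, 0 ≤ T → ‖∫ y, shiftKernel H x η y 0‖ ≤
      C * ((1 + T * L) ^ (d + 1 + 1) * Real.exp (-(T * δ))) * A := by
    intro T hT
    -- Shift to `τ = i T`.
    rw [integral_shiftKernel_eq hd hH x η 0 (T * Complex.I), ← integral_const_mul]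
    refine norm_integral_le_of_norm_le (hint.const_mul _) (.of_forall fun y => ?_)
    refine (hbd x η y _).trans (le_of_eq ?_)
    have him : ((T : ℂ) * Complex.I).im = T := by simp
    have hn : ‖(T : ℂ) * Complex.I‖ = T := by simp [abs_of_nonneg hT]
    have hmax : max (-m * (-(T * last η) - R * ‖T • bar η‖))
        (-M * (-(T * last η) - R * ‖T • bar η‖)) - T * inner ℝ x η = -(T * δ) := by
      rw [norm_smul, Real.norm_of_nonneg hT, hδ]
      rw [show -m * (-(T * last η) - R * (T * ‖bar η‖)) = T * (m * (last η + R * ‖bar η‖)) by ring,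
        show -M * (-(T * last η) - R * (T * ‖bar η‖)) = T * (M * (last η + R * ‖bar η‖)) by ring,
        ← mul_max_of_nonneg _ _ hT]
      ring
    rw [shiftBound, him, hn, hmax]
  have hlim : Tendsto (fun T : ℝ => C * ((1 + T * L) ^ (d + 1 + 1) * Real.exp (-(T * δ))) * A)
      atTop (nhds 0) := by
    simpa using ((tendsto_pow_mul_exp_neg L δ hδ0 (d + 1 + 1)).const_mul C).mul_const A
  have h0 := ge_of_tendsto hlim ((eventually_ge_atTop 0).mono hle)
  exact norm_le_zero_iff.1 h0

/-- The inversion integral of a function satisfying the Paley–Wiener bound vanishes off the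
truncated cone. -/
lemma integral_shiftKernel_eq_zero {d : ℕ} {m M R : ℝ} (hm : 0 < m) (hmM : m < M) (hR : 0 < R)
    {H : ℂ × EuclideanSpace ℂ (Fin d) → ℂ} (hd : Differentiable ℂ H)
    (hH : PaleyWienerBound m M R H) {x : E (d + 1)} (hx : x ∉ truncCone d m M R) :
    ∫ y, shiftKernel H x 0 y 0 = 0 := by
  -- At shift `0` the direction is irrelevant.
  have hη : ∀ η, ∫ y, shiftKernel H x 0 y 0 = ∫ y, shiftKernel H x η y 0 := by
    intro η
    simp [shiftKernel, shiftFreq]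
  -- The separating directions: `(0, -1)` below the cone, `(0, 1)` above it, and
  -- `(x̄, -R |x̄|)`, a normal to its lateral boundary, beside it.
  by_cases h1 : m ≤ last x
  · by_cases h2 : last x ≤ M
    · have h3 : R * last x < ‖bar x‖ := not_le.1 fun h => hx ⟨h1, h2, h⟩
      have h4 : 0 < ‖bar x‖ := lt_trans (mul_pos hR (hm.trans_le h1)) h3
      rw [hη (mk (bar x) (-(R * ‖bar x‖)))]
      refine integral_shiftKernel_eq_zero_of_separated hd hH x _ ?_
      rw [inner_eq_bar_last]
      simp only [bar_mk, last_mk, neg_add_cancel, mul_zero, max_self, real_inner_self_eq_norm_sq]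
      nlinarith
    · rw [hη (mk 0 1)]
      refine integral_shiftKernel_eq_zero_of_separated hd hH x _ ?_
      rw [inner_eq_bar_last]
      simpa using ⟨hmM.trans (not_le.1 h2), not_le.1 h2⟩
  · rw [hη (mk 0 (-1))]
    refine integral_shiftKernel_eq_zero_of_separated hd hH x _ ?_
    rw [inner_eq_bar_last]
    simpa using ⟨not_le.1 h1, (not_le.1 h1).trans hmM⟩

open scoped FourierTransform

/-! ### Reconstruction of the density -/

/-- The restriction `y ↦ H(-2π y_n, 2π ȳ)` to real frequencies, normalized for the Fourier
transform with kernel `e^{-2πi ⟨x, y⟩}`. -/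
def realTrace {d : ℕ} (H : ℂ × EuclideanSpace ℂ (Fin d) → ℂ) (y : E (d + 1)) : ℂ :=
  H (realFreq d ((2 * Real.pi) • y))

lemma exists_norm_realTrace_le {d : ℕ} {m M R : ℝ} {H : ℂ × EuclideanSpace ℂ (Fin d) → ℂ}
    (hH : PaleyWienerBound m M R H) (N : ℕ) :
    ∃ C, 0 < C ∧ ∀ y, ‖realTrace H y‖ ≤ C * ((1 + ‖y‖) ^ N)⁻¹ := by
  obtain ⟨C, hC, h⟩ := norm_shiftKernel_le hH N
  refine ⟨C, hC, fun y => ?_⟩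
  have h1 := h 0 0 ((2 * Real.pi) • y) 0
  have h2 : shiftKernel H 0 0 ((2 * Real.pi) • y) 0 = realTrace H y := by
    rw [shiftKernel, shiftFreq, zero_smul, add_zero, pairing_realFreq]
    simp [realTrace]
  have h3 : shiftBound m M R N (0 : E (d + 1)) 0 0 = 1 := by simp [shiftBound]
  rw [h2, h3, mul_one] at h1
  refine h1.trans ?_
  have h4 : ‖y‖ ≤ ‖(2 * Real.pi) • y‖ := by
    rw [norm_smul, Real.norm_of_nonneg (by positivity)]
    nlinarith [Real.two_le_pi, norm_nonneg y]
  gcongr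

lemma continuous_realTrace {d : ℕ} {H : ℂ × EuclideanSpace ℂ (Fin d) → ℂ} (hH : Continuous H) :
    Continuous (realTrace H) :=
  hH.comp ((realFreq d).continuous.comp (continuous_const_smul _))

lemma integrable_pow_mul_norm_realTrace {d : ℕ} {m M R : ℝ}
    {H : ℂ × EuclideanSpace ℂ (Fin d) → ℂ} (hc : Continuous H)
    (hH : PaleyWienerBound m M R H) (n : ℕ) :
    Integrable fun y => ‖y‖ ^ n * ‖realTrace H y‖ := by
  obtain ⟨C, hC, h⟩ := exists_norm_realTrace_le hH (n + (d + 1 + 1))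
  refine ((integrable_inv_one_add_norm_pow (d + 1)).const_mul C).mono'
    ((continuous_norm.pow n).mul (continuous_realTrace hc).norm).aestronglyMeasurable
    (.of_forall fun y => ?_)
  have h0 : 0 < 1 + ‖y‖ := by positivity
  rw [Real.norm_of_nonneg (by positivity)]
  calc ‖y‖ ^ n * ‖realTrace H y‖
      ≤ (1 + ‖y‖) ^ n * (C * ((1 + ‖y‖) ^ (n + (d + 1 + 1)))⁻¹) := by
        gcongr
        · linarith
        · exact h y
    _ = C * ((1 + ‖y‖) ^ (d + 1 + 1))⁻¹ := by
        rw [pow_add]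
        field_simp

lemma integrable_realTrace {d : ℕ} {m M R : ℝ} {H : ℂ × EuclideanSpace ℂ (Fin d) → ℂ}
    (hc : Continuous H) (hH : PaleyWienerBound m M R H) : Integrable (realTrace H) := by
  have h := integrable_pow_mul_norm_realTrace hc hH 0
  simp only [pow_zero, one_mul] at h
  exact (integrable_norm_iff (continuous_realTrace hc).aestronglyMeasurable).1 h

lemma contDiff_fourierInv_realTrace {d : ℕ} {m M R : ℝ}
    {H : ℂ × EuclideanSpace ℂ (Fin d) → ℂ} (hc : Continuous H)
    (hH : PaleyWienerBound m M R H) : ContDiff ℝ ∞ (𝓕⁻ (realTrace H)) := by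
  have h : ContDiff ℝ ∞ (𝓕 (realTrace H)) := Real.contDiff_fourier (N := ⊤) fun n _ =>
    integrable_pow_mul_norm_realTrace hc hH n
  have h2 : 𝓕⁻ (realTrace H) = fun x => 𝓕 (realTrace H) (-x) :=
    funext fun x => Real.fourierInv_eq_fourier_neg _ x
  rw [h2]
  exact h.comp contDiff_neg

lemma support_fourierInv_realTrace_subset {d : ℕ} {m M R : ℝ} (hm : 0 < m) (hmM : m < M)
    (hR : 0 < R) {H : ℂ × EuclideanSpace ℂ (Fin d) → ℂ} (hd : Differentiable ℂ H)
    (hH : PaleyWienerBound m M R H) :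
    Function.support (𝓕⁻ (realTrace H)) ⊆ truncCone d m M R := by
  intro x hx
  by_contra hn
  refine hx ?_
  have h1 : 𝓕⁻ (realTrace H) x = ∫ y, shiftKernel H x 0 ((2 * Real.pi) • y) 0 := by
    rw [Real.fourierInv_eq']
    refine integral_congr_ae (.of_forall fun y => ?_)
    simp only [shiftKernel, shiftFreq, zero_smul, add_zero, pairing_realFreq, realTrace,
      smul_eq_mul, inner_smul_right, real_inner_comm x y]
    rw [mul_comm Complex.I]
  rw [h1, Measure.integral_comp_smul volume (fun y => shiftKernel H x 0 y 0),
    integral_shiftKernel_eq_zero hm hmM hR hd hH hn, smul_zero]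

/-- Continuous integrable functions are determined by their Fourier transforms. -/
lemma eq_of_fourier_eq {n : ℕ} {f g : E n → ℂ} (hf : Continuous f) (hg : Continuous g)
    (hfi : Integrable f) (hgi : Integrable g) (h : ∀ ξ, 𝓕 f ξ = 𝓕 g ξ) : f = g := by
  have h0 : 𝓕 (f - g) = 0 := by
    ext ξ
    have h1 : 𝓕 (f - g) ξ = 𝓕 f ξ - 𝓕 g ξ := by
      simp only [Real.fourier_eq, Pi.sub_apply, smul_sub]
      exact integral_sub ((Real.fourierIntegral_convergent_iff ξ).2 hfi)
        ((Real.fourierIntegral_convergent_iff ξ).2 hgi)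
    rw [h1, h, sub_self, Pi.zero_apply]
  have h3 := (hf.sub hg).fourierInv_fourier_eq (hfi.sub hgi) (by
    change Integrable (𝓕 (f - g))
    rw [h0]
    exact integrable_zero _ _ _)
  change 𝓕⁻ (𝓕 (f - g)) = f - g at h3
  have h4 : 𝓕⁻ (𝓕 (f - g)) = 0 := by
    rw [h0]
    ext x
    simp [Real.fourierInv_eq]
  exact sub_eq_zero.1 (h3.symm.trans h4)

/-- The data are the line integrals of the inverse transform: both have the same Fourier transform
in the projective variable. -/
lemma eq_integral_line_fourierInv {d : ℕ} {m M R : ℝ} (hm : 0 < m) (hmM : m < M) (hR : 0 < R)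
    {w : E d → E d → ℝ} {c : ℕ → ℕ → MvPolynomial (Fin d) ℝ}
    {H : ℂ × EuclideanSpace ℂ (Fin d) → ℂ} (hc : IsMomentCoeff w c) (hH : IsEntireSum c H)
    (hPW : PaleyWienerBound m M R H) (a : E d) (hw : Continuous (w a))
    (hwc : HasCompactSupport (w a)) (p : E d) :
    (w a p : ℂ) = ∫ s, 𝓕⁻ (realTrace H) (mk (p + s • a) s) := by
  set g := 𝓕⁻ (realTrace H) with hg
  have hgs := support_fourierInv_realTrace_subset hm hmM hR hH.1 hPW
  have hgsmooth : ContDiff ℝ ∞ g := contDiff_fourierInv_realTrace hH.1.continuous hPW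
  have hgc : HasCompactSupport g :=
    HasCompactSupport.of_support_subset_isCompact (isCompact_truncCone d hR.le) hgs
  have hgcont := hgsmooth.continuous
  have hinv : 𝓕 g = realTrace H := by
    refine (continuous_realTrace hH.1.continuous).fourier_fourierInv_eq
      (integrable_realTrace hH.1.continuous hPW) ?_
    have h1 : 𝓕 (realTrace H) = fun x => g (-x) := by
      ext x
      rw [hg, Real.fourierInv_eq_fourier_neg, neg_neg]
    rw [h1]
    exact (hgcont.integrable_of_hasCompactSupport hgc).comp_neg
  have hwC : Continuous fun p => (w a p : ℂ) := Complex.continuous_ofReal.comp hw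
  have hwcC : HasCompactSupport fun p => (w a p : ℂ) := hwc.comp_left Complex.ofReal_zero
  have hl := continuous_integral_line a hgcont hgc
  have hlc := hasCompactSupport_integral_line a hgc
  refine congrFun (eq_of_fourier_eq hwC hl (hwC.integrable_of_hasCompactSupport hwcC)
    (hl.integrable_of_hasCompactSupport hlc) fun ξ => ?_) p
  -- Both transforms at `ξ` equal the value of `H` at `(2π a · ξ, 2π ξ)`.
  have e1 : 𝓕 (fun p => (w a p : ℂ)) ξ = realTrace H (mk ξ (-inner ℝ a ξ)) := by
    have h1 := integral_exp_mul_eq_of_isEntireSum hc hH a hw hwc ((2 * Real.pi) • ξ)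
    rw [Real.fourier_eq', realTrace, realFreq_apply, bar_smul, last_smul, bar_mk, last_mk,
      mul_neg, Complex.ofReal_neg, neg_neg, ← inner_smul_right a ξ (2 * Real.pi)]
    refine Eq.trans (integral_congr_ae (.of_forall fun p => ?_)) h1
    simp only [smul_eq_mul, inner_smul_right, Complex.ofReal_mul]
    congr 2
    push_cast
    ring
  have e2 : 𝓕 (fun p => ∫ s, g (mk (p + s • a) s)) ξ = 𝓕 g (mk ξ (-inner ℝ a ξ)) := by
    rw [Real.fourier_eq', Real.fourier_eq']
    simp only [smul_eq_mul]
    rw [integral_mul_integral_line a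
      (φ := fun p => Complex.exp (((-2 * Real.pi * inner ℝ p ξ : ℝ) : ℂ) * Complex.I))
      (by fun_prop) hgcont hgc]
    refine integral_congr_ae (.of_forall fun x => ?_)
    simp only [inner_eq_bar_last x, bar_mk, last_mk, inner_sub_left, inner_smul_left]
    congr 4
    simp
    ring
  rw [e1, e2, hinv]

lemma exists_isTestFunction_of_conditions {d : ℕ} {w : E d → E d → ℝ}
    (hw : ∀ a, Continuous (w a)) (hwc : ∀ a, HasCompactSupport (w a))
    {c : ℕ → ℕ → MvPolynomial (Fin d) ℝ} (hc : IsMomentCoeff w c)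
    {H : ℂ × EuclideanSpace ℂ (Fin d) → ℂ} (hH : IsEntireSum c H)
    {m M R : ℝ} (hm : 0 < m) (hmM : m < M) (hR : 0 < R) (hPW : PaleyWienerBound m M R H) :
    ∃ g : E (d + 1) → ℝ, IsTestFunction g ∧ ∀ a p, w a p = ∫ s, g (mk (p + s • a) s) := by
  set g := 𝓕⁻ (realTrace H)
  have hgs := support_fourierInv_realTrace_subset hm hmM hR hH.1 hPW
  have hgsmooth : ContDiff ℝ ∞ g := contDiff_fourierInv_realTrace hH.1.continuous hPW
  have hgc : HasCompactSupport g :=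
    HasCompactSupport.of_support_subset_isCompact (isCompact_truncCone d hR.le) hgs
  -- The data are real, so the imaginary part of `g` contributes nothing.
  refine ⟨fun x => (g x).re, isTestFunction_of_support_subset
    (Complex.reCLM.contDiff.comp hgsmooth) hm hR.le fun x hx => hgs fun h =>
      hx (congrArg Complex.re h), fun a p => ?_⟩
  have h := eq_integral_line_fourierInv hm hmM hR hc hH hPW a (hw a) (hwc a) p
  have hint : Integrable fun s => g (mk (p + s • a) s) := by
    refine Continuous.integrable_of_hasCompactSupport
      (hgsmooth.continuous.comp (by fun_prop)) ?_
    refine HasCompactSupport.intro (K := last '' tsupport g)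
      (IsCompact.image hgc continuous_last) fun s hs => ?_
    exact image_eq_zero_of_notMem_tsupport fun h => hs ⟨_, h, last_mk _ _⟩
  rw [← Complex.ofReal_re (w a p), h]
  exact (Complex.reCLM.integral_comp_comm hint).symm

end DivergentBeam

end
theorem mainTheorem4 (d : ℕ) (hd : 1 ≤ d) (k : ℕ)
    (u : DivergentBeam.E d × DivergentBeam.upperHemisphere d → ℝ)
    (hu : DivergentBeam.SmoothData u) :
    (∃ f : DivergentBeam.E (d + 1) → ℝ, DivergentBeam.IsTestFunction f ∧
      ∀ (a : DivergentBeam.E d) (v : DivergentBeam.upperHemisphere d),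
        u (a, v) =
          DivergentBeam.beamTransform k f (DivergentBeam.mk a 0) (DivergentBeam.dirVec v)) ↔
    ((∀ a : DivergentBeam.E d, HasCompactSupport (DivergentBeam.scaledData k u a)) ∧
      ∃ c : ℕ → ℕ → MvPolynomial (Fin d) ℝ,
        DivergentBeam.IsMomentCoeff (DivergentBeam.scaledData k u) c ∧
        ∃ H : ℂ × EuclideanSpace ℂ (Fin d) → ℂ,
          DivergentBeam.IsEntireSum c H ∧
          ∃ m₀ M₀ R : ℝ, 0 < m₀ ∧ m₀ < M₀ ∧ 0 < R ∧
            DivergentBeam.PaleyWienerBound m₀ M₀ R H) := by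
  rw [DivergentBeam.exists_beamTransform_iff]
  constructor
  · rintro ⟨g, hg, hw⟩
    obtain ⟨m, M, R, hm, hmM, hR, hs⟩ := hg.exists_support_subset
    refine ⟨fun a => ?_, DivergentBeam.momentPoly g,
      DivergentBeam.isMomentCoeff_momentPoly hg.1.continuous hg.2.1 hw, _,
      DivergentBeam.isEntireSum_fourierLaplace hg.1.continuous hg.2.1, m, M, R, hm, hmM, hR,
      DivergentBeam.paleyWienerBound_fourierLaplace hR.le
        (Complex.ofRealCLM.contDiff.comp hg.1) fun x hx => hs fun h => hx (by simp [h])⟩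
    rw [funext (hw a)]
    exact DivergentBeam.hasCompactSupport_integral_line a hg.2.1
  · rintro ⟨hwc, c, hc, H, hH, m, M, R, hm, hmM, hR, hPW⟩
    exact DivergentBeam.exists_isTestFunction_of_conditions
      (DivergentBeam.continuous_scaledData k hu) hwc hc hH hm hmM hR hPW
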